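/- Let $(R,\mathfrak m)$ be a commutative Noetherian local ring. Work in the derived category $D(R)$ with homological grading. For $M\in D(R)$ let $\sup M$ and $\inf M$ be the supremum and the infimum of $\{i\in\mathbb Z : H_i(M)\neq 0\}$, let $\operatorname{Supp}_R M=\{\mathfrak p\in\operatorname{Spec}R : M_{\mathfrak p}\not\simeq 0\}$, and put $$\dim_R M=\sup\{\dim R/\mathfrak p-\inf M_{\mathfrak p} : \mathfrak p\in\operatorname{Supp}_R M\}$$ (with $\sup\emptyset=-\infty$ and $\inf\emptyset=+\infty$). If the homology of $M$ is bounded below, a prime $\mathfrak p\in\operatorname{Supp}_R M$ is an anchor prime of $M$ if $\dim_{R_{\mathfrak p}}M_{\mathfrak p}=-\inf M_{\mathfrak p}$; let $\operatorname{Anc}_R M$ be the set of anchor primes. Call $M$ equidimensional if $$\operatorname{Anc}_R M=\{\mathfrak p\in\operatorname{Supp}_R M : \dim R/\mathfrak p=\dim_R M+\inf M_{\mathfrak p}\}.$$ 1. Suppose that $R$ is catenary, and let $M\in D(R)$ have homology bounded below, that is, $H_i(M)=0$ for $i\ll 0$. Then $M$ is equidimensional if and only if $\dim_R M=\dim_{R_{\mathfrak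 p}}M_{\mathfrak p}+\dim R/\mathfrak p$ for every $\mathfrak p\in\operatorname{Supp}_R M$. 2. Suppose that $R$ admits a dualizing complex, and let $D_R$ be one, normalized so that $\sup D_R=\dim R$. Let $M\in D(R)$ have bounded homology with all $H_i(M)$ finitely generated, and put $M^\dagger=\mathbf R\mathrm{Hom}_R(M,D_R)$. Then $M^\dagger$ is equidimensional if and only if $\sup M=\sup M_{\mathfrak p}$ for every $\mathfrak p\in\operatorname{Supp}_R M$. -/

import Mathlib

open CategoryTheory

universe u

/-! Objects of the derived category `D(R)` are represented by unbounded complexes of `R`-modules.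
Mathlib's complexes indexed by `ℤ` are graded cohomologically; the homological grading is recovered
by `M_i = M.X (-i)`. -/

/-- Complexes of `R`-modules, indexed by `ℤ`. -/
abbrev ModComplex (R : Type u) [CommRing R] : Type (u + 1) :=
  CochainComplex (ModuleCat.{u} R) ℤ

namespace ModComplex

noncomputable section

/-- The homology module `H_i(M)` (homological grading). -/
abbrev homologyModule {R : Type u} [CommRing R] (M : ModComplex R) (i : ℤ) : ModuleCat.{u} R :=
  M.homology (-i)

/-- The degrees `i` with `H_i(M) ≠ 0`. -/
def homologicalDegrees {R : Type u} [CommRing R] (M : ModComplex R) : Set ℤ :=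
  {i | ¬ Limits.IsZero (M.homologyModule i)}

/-- The homological infimum `inf M` in the extended reals (`⊤` if `M` is acyclic). -/
def hInf {R : Type u} [CommRing R] (M : ModComplex R) : EReal :=
  ⨅ i ∈ M.homologicalDegrees, ((i : ℝ) : EReal)

/-- The homological supremum `sup M` in the extended reals (`⊥` if `M` is acyclic). -/
def hSup {R : Type u} [CommRing R] (M : ModComplex R) : EReal :=
  ⨆ i ∈ M.homologicalDegrees, ((i : ℝ) : EReal)

/-- `M ∈ D_+(R)`: the homology is bounded below (in the homological grading). -/
def HomologicallyBoundedBelow {R : Type u} [CommRing R] (M : ModComplex R) : Prop :=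
  ∃ a : ℤ, ∀ i ∈ M.homologicalDegrees, a ≤ i

/-- `M ∈ D_-(R)`: the homology is bounded above (in the homological grading). -/
def HomologicallyBoundedAbove {R : Type u} [CommRing R] (M : ModComplex R) : Prop :=
  ∃ b : ℤ, ∀ i ∈ M.homologicalDegrees, i ≤ b

/-- `M ∈ D^f_b(R)`: the homology is bounded and all homology modules are finitely generated. -/
structure HomologicallyBoundedFinite {R : Type u} [CommRing R] (M : ModComplex R) : Prop where
  below : M.HomologicallyBoundedBelow
  above : M.HomologicallyBoundedAbove
  finite : ∀ i : ℤ, Module.Finite R (M.homologyModule i)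

/-- The localized complex `M_p`, a complex of modules over `R_p`. -/
abbrev localization {R : Type u} [CommRing R] (M : ModComplex R) (p : PrimeSpectrum R) :
    ModComplex (Localization.AtPrime p.asIdeal) :=
  ((ModuleCat.localizedModuleFunctor.{u} p.asIdeal.primeCompl).mapHomologicalComplex
    (ComplexShape.up ℤ)).obj M

/-- The (homological) support: the primes `p` such that `M_p` is not zero in `D(R_p)`, that is,
such that `M_p` is not acyclic. -/
def support {R : Type u} [CommRing R] (M : ModComplex R) : Set (PrimeSpectrum R) :=
  {p | ¬ (M.localization p).Acyclic}

end

end ModComplex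

/-- The Krull dimension of a ring, as an extended real number. -/
noncomputable def krullDimEReal (A : Type u) [CommRing A] : EReal :=
  WithBot.recBotCoe (C := fun _ => EReal) ⊥ (fun n : ℕ∞ => ((n : ENNReal) : EReal))
    (ringKrullDim A)

/-- A ring is catenary if for all primes `p`, `q` there is a bound on the lengths of the chains of
primes from `p` to `q`, and all saturated such chains have the same length. -/
def IsCatenaryRing (R : Type u) [CommRing R] : Prop :=
  ∀ p q : PrimeSpectrum R,
    (∃ N : ℕ, ∀ s : LTSeries (PrimeSpectrum R), s.head = p → s.last = q → s.length ≤ N) ∧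
    ∀ s t : RelSeries {(a, b) : PrimeSpectrum R × PrimeSpectrum R | a ⋖ b},
      s.head = p → s.last = q → t.head = p → t.last = q → s.length = t.length

namespace ModComplex

noncomputable section

/-- The Krull dimension `dim_R M = sup {dim R/p - inf M_p | p ∈ Supp M}` (`⊥` if `M` is acyclic). -/
def dim {R : Type u} [CommRing R] (M : ModComplex R) : EReal :=
  ⨆ p ∈ M.support, (krullDimEReal (R ⧸ p.asIdeal) - (M.localization p).hInf)

/-- The anchor primes of `M`: the `p ∈ Supp M` with `dim_{R_p} M_p = - inf M_p`. -/
def anchorPrimes {R : Type u} [CommRing R] (M : ModComplex R) : Set (PrimeSpectrum R) :=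
  {p ∈ M.support | (M.localization p).dim = -(M.localization p).hInf}

/-- `M` is equidimensional if `Anc M = {p ∈ Supp M | dim R/p = dim M + inf M_p}`. -/
def IsEquidimensional {R : Type u} [CommRing R] (M : ModComplex R) : Prop :=
  M.anchorPrimes =
    {p ∈ M.support | krullDimEReal (R ⧸ p.asIdeal) = M.dim + (M.localization p).hInf}

open CochainComplex.HomComplex in
/-- The complex `Hom_R(M, N)` of `R`-modules: in cohomological degree `n` it is
`∏ Hom_R(M^p, N^{p+n})`, with the usual differential `f ↦ d ∘ f ± f ∘ d`. If `N` is a bounded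
complex of injective modules, it represents `RHom_R(M, N)`. -/
def homComplex {R : Type u} [CommRing R] (M N : ModComplex R) : ModComplex R where
  X n := ModuleCat.of R (Cochain M N n)
  d n m := ModuleCat.ofHom (δ_hom R M N n m)
  shape n m h := by
    ext z
    simp [δ_shape n m h]
  d_comp_d' n m k _ _ := by
    ext z
    simp [δ_δ]

open CochainComplex.HomComplex in
/-- The homothety morphism `R ⟶ Hom_R(D, D)`, `r ↦ r • id`, where `R` sits in degree zero. -/
def homothety {R : Type u} [CommRing R] (D : ModComplex R) :
    (HomologicalComplex.single (ModuleCat.{u} R) (ComplexShape.up ℤ) 0).obj (ModuleCat.of R R) ⟶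
      homComplex D D :=
  HomologicalComplex.mkHomFromSingle
    (ModuleCat.ofHom (LinearMap.toSpanSingleton R (Cochain D D 0) (Cochain.ofHom (𝟙 D))))
    (by
      intro k _
      ext
      change δ 0 k ((1 : R) • Cochain.ofHom (𝟙 D)) = 0
      simp)

/-- A dualizing complex, given by a bounded complex of injective modules: its homology modules are
finitely generated and the homothety morphism `R ⟶ Hom_R(D, D) = RHom_R(D, D)` is a
quasi-isomorphism. -/
structure IsDualizing {R : Type u} [CommRing R] (D : ModComplex R) : Prop where
  bounded : ∃ a b : ℤ, ∀ n : ℤ, (n < a ∨ b < n) → Limits.IsZero (D.X n)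
  injective : ∀ n : ℤ, Injective (D.X n)
  finite : ∀ i : ℤ, Module.Finite R (D.homologyModule i)
  homothety_quasiIso : QuasiIso D.homothety

/-- A dualizing complex normalized by `sup D = dim R`. -/
structure IsNormalizedDualizing {R : Type u} [CommRing R] (D : ModComplex R) : Prop extends
    IsDualizing D where
  hSup_eq : D.hSup = krullDimEReal R

/-- The dagger dual `M^† = RHom_R(M, D)` with respect to a dualizing complex `D`
(a bounded complex of injective modules). -/
abbrev dagger {R : Type u} [CommRing R] (M D : ModComplex R) : ModComplex R :=
  homComplex M D

end

end ModComplex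

/-!
For primes `q ≤ p` let `d(q, p)` be the maximal length of a chain of primes from `q` to `p`
(`intervalDim`). If the homology of `M` is bounded below, then `dim M_p` is the maximum of the
integers `d(q, p) - inf M_q` over the `q ≤ p` in the support of `M`, and `dim M = dim M_m` for the
maximal ideal `m`. If the maximum for `p` is attained at `q`, then, by additivity of `d` in a
catenary ring, `q` is an anchor prime of `M`. Thus, for equidimensional `M`, the identity
`d(q, m) = dim M + inf M_q` holds, and subtracting `dim M_p = d(q, p) - inf M_q` gives
`dim M = dim M_p + dim R/p`. The converse is immediate
(`ModComplex.isEquidimensional_iff_forall_add`).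

For the dagger dual, the key is a function `e` on primes such that `Ext^n(R/p, D)_p ≠ 0` exactly for
`n = e p` (`ModComplex.IsDualizing.exists_isDegreeFunction`). The existence comes from biduality,
`T ≃ RHom(RHom(T, D), D)` for finitely generated modules `T`, which is deduced from the homothety
isomorphism by means of free presentations: if the local Ext modules of `R/p` lived in several
degrees, the extreme ones would produce cohomology of the bidual of `R/p` in a negative degree.
Nakayama's lemma shows that `e` increases by one along coverings of primes
(`ModComplex.IsDualizing.degree_eq_of_covBy`) and that `Ext^n(T, D)_p = 0` for `n > e p`. In
particular `R` is catenary and `d(q, p) = e p - e q`.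

The passage from modules to complexes is the spectral sequence
`Ext^q(H^p(M), D) ⇒ H^(q-p)(RHom(M, D))`, which is not constructed; the two facts needed from it,
a vanishing statement (`ModComplex.exists_smul_eq_δ`) and the survival of a corner
(`ModComplex.exists_cocycle_not_tors`), are proved by solving `δ h = γ` for cochains degree by
degree. Localization at `p` is expressed by torsion with respect to the complement of `p`
(`ModComplex.ExtTors`), so that no statement about injective modules over localized rings is needed.
The result is `inf (M^†)_p ≥ -(e p + sup M_p)`, with equality if `p` is associated to the top
homology module of `M_p`. Hence `dim (M^†)_p = e p + sup M_p`
(`ModComplex.IsDualizing.isDimFunction_dagger`), and the first part, applied to `M^†`, yields the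
second.
-/

namespace ModComplex

variable {R : Type u} [CommRing R]

/-! ### Extending and factoring linear maps -/

theorem exists_extension {Q : ModuleCat.{u} R} (hQ : Injective Q) {A B : Type u}
    [AddCommGroup A] [Module R A] [AddCommGroup B] [Module R B] (i : A →ₗ[R] B)
    (hi : Function.Injective i) (f : A →ₗ[R] Q) : ∃ g : B →ₗ[R] Q, g ∘ₗ i = f := by
  have : Injective (ModuleCat.of R Q) := hQ
  obtain ⟨g, hg⟩ := (Module.injective_module_of_injective_object R Q).out i hi f
  exact ⟨g, LinearMap.ext hg⟩

theorem exists_descent_of_ker {B C Q : Type*} [AddCommGroup B] [Module R B] [AddCommGroup C]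
    [Module R C] [AddCommGroup Q] [Module R Q] {q : B →ₗ[R] C} (hq : Function.Surjective q)
    (f : B →ₗ[R] Q) (hf : ∀ x, q x = 0 → f x = 0) : ∃ g : C →ₗ[R] Q, ∀ x, g (q x) = f x := by
  refine ⟨(LinearMap.ker q).liftQ f hf ∘ₗ (q.quotKerEquivOfSurjective hq).symm, fun x => ?_⟩
  have : (q.quotKerEquivOfSurjective hq).symm (q x) = Submodule.Quotient.mk x := by
    rw [LinearEquiv.symm_apply_eq]; rfl
  rw [LinearMap.comp_apply, LinearEquiv.coe_coe, this]
  exact Submodule.liftQ_apply _ _ _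

theorem exists_descent {A B C Q : Type*} [AddCommGroup A] [Module R A] [AddCommGroup B]
    [Module R B] [AddCommGroup C] [Module R C] [AddCommGroup Q] [Module R Q] {i : A →ₗ[R] B}
    {q : B →ₗ[R] C} (hq : Function.Surjective q) (h : Function.Exact i q) (f : B →ₗ[R] Q)
    (hf : f ∘ₗ i = 0) : ∃ g : C →ₗ[R] Q, g ∘ₗ q = f := by
  obtain ⟨g, hg⟩ := exists_descent_of_ker hq f (fun x hx => by
    obtain ⟨y, rfl⟩ := (h x).1 hx
    exact LinearMap.congr_fun hf y)
  exact ⟨g, LinearMap.ext hg⟩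

/-- If `f` vanishes on the kernel of `q` and its target is injective, then `f` factors through `q`,
even if `q` is not surjective. -/
theorem exists_factor {Q : ModuleCat.{u} R} (hQ : Injective Q) {A B : Type u}
    [AddCommGroup A] [Module R A] [AddCommGroup B] [Module R B] (q : A →ₗ[R] B)
    (f : A →ₗ[R] Q) (hf : ∀ x, q x = 0 → f x = 0) : ∃ g : B →ₗ[R] Q, g ∘ₗ q = f := by
  obtain ⟨g, hg⟩ := exists_extension hQ ((LinearMap.ker q).liftQ q le_rfl)
    (LinearMap.ker_eq_bot.1 (Submodule.ker_liftQ_eq_bot _ _ _ le_rfl))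
    ((LinearMap.ker q).liftQ f hf)
  refine ⟨g, LinearMap.ext fun x => ?_⟩
  exact LinearMap.congr_fun hg (Submodule.Quotient.mk x)

@[simp] theorem d_d_apply (D : ModComplex R) (a b c : ℤ) (x : D.X a) :
    (D.d b c).hom ((D.d a b).hom x) = 0 := by
  rw [← ModuleCat.comp_apply]
  simp

/-! ### Torsion of the cohomology of `Hom(T, D)` -/

/-- Every class in `Hⁿ(Hom_R(T, D))` is annihilated by an element of the multiplicative set `S`;
for `D` a bounded complex of injective modules this says `S⁻¹ Extⁿ(T, D) = 0`. -/
def ExtTors (S : Submonoid R) (D : ModComplex R) (T : Type u) [AddCommGroup T] [Module R T]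
    (n : ℤ) : Prop :=
  ∀ a c : ℤ, a + 1 = n → n + 1 = c → ∀ f : T →ₗ[R] D.X n, (∀ x, (D.d n c).hom (f x) = 0) →
    ∃ s ∈ S, ∃ g : T →ₗ[R] D.X a, ∀ x, s • f x = (D.d a n).hom (g x)

section HalfExact

variable {S : Submonoid R} {D : ModComplex R} (hD : ∀ n, Injective (D.X n))
  {T₁ T₂ T₃ : Type u} [AddCommGroup T₁] [Module R T₁] [AddCommGroup T₂] [Module R T₂]
  [AddCommGroup T₃] [Module R T₃]

theorem ExtTors.of_linearEquiv {n : ℤ} (h : ExtTors S D T₁ n) (e : T₁ ≃ₗ[R] T₂) :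
    ExtTors S D T₂ n := by
  intro a c ha hc f hf
  obtain ⟨s, hs, g, hg⟩ := h a c ha hc (f ∘ₗ e.toLinearMap) (fun x => hf _)
  exact ⟨s, hs, g ∘ₗ e.symm.toLinearMap, fun x => by simpa using hg (e.symm x)⟩

theorem ExtTors.of_smul_eq_zero (n : ℤ) {s : R} (hs : s ∈ S) (h : ∀ x : T₁, s • x = 0) :
    ExtTors S D T₁ n := by
  intro a c ha hc f hf
  exact ⟨s, hs, 0, fun x => by simp [← map_smul, h]⟩

theorem ExtTors.of_isZero {n : ℤ} (h : Limits.IsZero (D.X n)) : ExtTors S D T₁ n := by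
  intro a c ha hc f hf
  have := ModuleCat.subsingleton_of_isZero h
  exact ⟨1, S.one_mem, 0, fun x => Subsingleton.elim _ _⟩

variable {i : T₁ →ₗ[R] T₂} {q : T₂ →ₗ[R] T₃}

include hD in
/-- Exactness of `Extⁿ(T₃, D) → Extⁿ(T₂, D) → Extⁿ(T₁, D)` after localization at `S`. -/
theorem ExtTors.middle (hi : Function.Injective i) (hq : Function.Surjective q)
    (hiq : Function.Exact i q) {n : ℤ} (h₁ : ExtTors S D T₁ n) (h₃ : ExtTors S D T₃ n) :
    ExtTors S D T₂ n := by
  intro a c ha hc f hf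
  obtain ⟨s, hs, g', hg'⟩ := h₁ a c ha hc (f ∘ₗ i) (fun x => hf _)
  obtain ⟨g, hg⟩ := exists_extension (hD a) i hi g'
  obtain ⟨f₃, hf₃⟩ := exists_descent hq hiq (s • f - (D.d a n).hom ∘ₗ g) (by
    ext x
    have := LinearMap.congr_fun hg x
    simp only [LinearMap.comp_apply] at this
    simpa [this, sub_eq_zero] using hg' x)
  have hf₃' := fun x => LinearMap.congr_fun hf₃ x
  simp only [LinearMap.comp_apply, LinearMap.sub_apply, LinearMap.smul_apply] at hf₃'
  obtain ⟨t, ht, g₃, hg₃⟩ := h₃ a c ha hc f₃ (fun x => by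
    obtain ⟨y, rfl⟩ := hq x
    simp [hf₃', hf])
  refine ⟨t * s, S.mul_mem ht hs, g₃ ∘ₗ q + t • g, fun x => ?_⟩
  have := hg₃ (q x)
  rw [hf₃', smul_sub, sub_eq_iff_eq_add] at this
  simp [mul_smul, this]

include hD in
/-- Exactness of `Extⁿ(T₂, D) → Extⁿ(T₁, D) → Extⁿ⁺¹(T₃, D)` after localization at `S`. -/
theorem ExtTors.left (hi : Function.Injective i) (hq : Function.Surjective q)
    (hiq : Function.Exact i q) {n m : ℤ} (hnm : n + 1 = m) (h₂ : ExtTors S D T₂ n)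
    (h₃ : ExtTors S D T₃ m) : ExtTors S D T₁ n := by
  intro a c ha hc f hf
  obtain rfl : c = m := by omega
  obtain ⟨f₂, hf₂⟩ := exists_extension (hD n) i hi f
  have hf₂' := fun x => LinearMap.congr_fun hf₂ x
  simp only [LinearMap.comp_apply] at hf₂'
  obtain ⟨f₃, hf₃⟩ := exists_descent hq hiq ((D.d n c).hom ∘ₗ f₂) (by
    ext x
    simp [hf₂', hf])
  have hf₃' := fun x => LinearMap.congr_fun hf₃ x
  simp only [LinearMap.comp_apply] at hf₃'
  obtain ⟨s, hs, g₃, hg₃⟩ := h₃ n (c + 1) hnm rfl f₃ (fun x => by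
    obtain ⟨y, rfl⟩ := hq x
    simp [hf₃'])
  obtain ⟨t, ht, g, hg⟩ := h₂ a c ha hc (s • f₂ - g₃ ∘ₗ q) (fun x => by
    simp [← hg₃, hf₃'])
  refine ⟨t * s, S.mul_mem ht hs, g ∘ₗ i, fun x => ?_⟩
  simp [mul_smul, ← hg, hf₂', hiq.apply_apply_eq_zero]

include hD in
/-- Exactness of `Extⁿ(T₁, D) → Extⁿ⁺¹(T₃, D) → Extⁿ⁺¹(T₂, D)` after localization at `S`. -/
theorem ExtTors.right (hi : Function.Injective i) (hq : Function.Surjective q)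
    (hiq : Function.Exact i q) {n m : ℤ} (hnm : n + 1 = m) (h₁ : ExtTors S D T₁ n)
    (h₂ : ExtTors S D T₂ m) : ExtTors S D T₃ m := by
  intro a c ha hc f hf
  obtain rfl : a = n := by omega
  obtain ⟨s, hs, g, hg⟩ := h₂ a c ha hc (f ∘ₗ q) (fun x => hf _)
  obtain ⟨t, ht, u, hu⟩ := h₁ (a - 1) m (by omega) hnm (g ∘ₗ i) (fun x => by
    simp [← hg, hiq.apply_apply_eq_zero])
  obtain ⟨v, hv⟩ := exists_extension (hD (a - 1)) i hi u
  have hv' := fun x => LinearMap.congr_fun hv x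
  simp only [LinearMap.comp_apply] at hv'
  obtain ⟨g₃, hg₃⟩ := exists_descent hq hiq (t • g - (D.d (a - 1) a).hom ∘ₗ v) (by
    ext x
    simp [hv', ← hu])
  have hg₃' := fun x => LinearMap.congr_fun hg₃ x
  simp only [LinearMap.comp_apply] at hg₃'
  refine ⟨t * s, S.mul_mem ht hs, g₃, fun x => ?_⟩
  obtain ⟨y, rfl⟩ := hq x
  have := hg y
  simp only [LinearMap.comp_apply] at this
  simp [hg₃', mul_smul, this]

end HalfExact

/-! ### Homology classes -/

/-- The homology class of a cocycle of a complex of modules. -/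
noncomputable def homologyClass (M : ModComplex R) (k l : ℤ) (hl : k + 1 = l) :
    LinearMap.ker (M.d k l).hom →ₗ[R] M.homology k :=
  (M.liftCycles (ModuleCat.ofHom (LinearMap.ker (M.d k l).hom).subtype) l (by simp [hl])
    (by ext x; exact x.2) ≫ M.homologyπ k).hom

theorem liftCycles_ker_surjective (M : ModComplex R) (k l : ℤ) (hl : k + 1 = l) :
    Function.Surjective (M.liftCycles (ModuleCat.ofHom (LinearMap.ker (M.d k l).hom).subtype) l
      (by simp [hl]) (by ext x; exact x.2)).hom := by
  intro z
  refine ⟨⟨(M.iCycles k).hom z, ?_⟩, ?_⟩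
  · rw [LinearMap.mem_ker, ← ModuleCat.comp_apply]
    simp
  · apply (ModuleCat.mono_iff_injective (M.iCycles k)).1 inferInstance
    rw [← ModuleCat.comp_apply]
    simp

theorem homologyClass_surjective (M : ModComplex R) (k l : ℤ) (hl : k + 1 = l) :
    Function.Surjective (homologyClass M k l hl) := by
  rw [homologyClass, ModuleCat.hom_comp, LinearMap.coe_comp]
  exact ((ModuleCat.epi_iff_surjective (M.homologyπ k)).1 inferInstance).comp
    (liftCycles_ker_surjective M k l hl)

theorem homologyClass_eq_zero_iff (M : ModComplex R) (j k l : ℤ) (hj : j + 1 = k) (hl : k + 1 = l)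
    (x : LinearMap.ker (M.d k l).hom) :
    homologyClass M k l hl x = 0 ↔ ∃ y, (M.d j k).hom y = x := by
  have hex := (ShortComplex.exact_of_g_is_cokernel
    (ShortComplex.mk (M.toCycles j k) (M.homologyπ k) (by simp))
    (M.homologyIsCokernel j k (by simp [← hj])))
  rw [ShortComplex.moduleCat_exact_iff] at hex
  have hinj := (ModuleCat.mono_iff_injective (M.iCycles k)).1 inferInstance
  have h₁ : (M.iCycles k).hom ((M.liftCycles
      (ModuleCat.ofHom (LinearMap.ker (M.d k l).hom).subtype) l
      (by simp [hl]) (by ext x; exact x.2)).hom x) = x := by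
    rw [← ModuleCat.comp_apply, M.liftCycles_i]
    rfl
  have h₂ (y) : (M.iCycles k).hom ((M.toCycles j k).hom y) = (M.d j k).hom y := by
    rw [← ModuleCat.comp_apply, M.toCycles_i]
  constructor
  · intro h
    obtain ⟨y, hy⟩ := hex _ h
    exact ⟨y, by rw [← h₂, ← h₁]; exact congrArg (M.iCycles k).hom hy⟩
  · rintro ⟨y, hy⟩
    have := hinj (((h₁.trans hy.symm).trans (h₂ y).symm))
    rw [homologyClass, ModuleCat.hom_comp, LinearMap.comp_apply, this, ← ModuleCat.comp_apply]
    simp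

/-! ### Lifting cochains degree by degree -/

section Core

open CochainComplex.HomComplex

variable {S : Submonoid R} {M D : ModComplex R}

theorem δ_v_apply {n m : ℤ} (hnm : n + 1 = m) (z : Cochain M D n) (p q p' q' : ℤ)
    (hpq : p + m = q) (hp' : p + 1 = p') (hq' : p + n = q') (hp'q : p' + n = q) (x : M.X p) :
    ((δ n m z).v p q hpq).hom x = (D.d q' q).hom ((z.v p q' hq').hom x) +
      ((m.negOnePow : ℤˣ) : ℤ) • (z.v p' q hp'q).hom ((M.d p p').hom x) := by
  rw [δ_v n m hnm z p q hpq q' p' (by omega) (by omega)]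
  rfl

theorem isUnit_negOnePow_smul (m : ℤ) {A : Type*} [AddCommGroup A] (x : A) :
    ((m.negOnePow : ℤˣ) : ℤ) • x = 0 ↔ x = 0 := by
  rw [← Units.smul_def, smul_eq_zero_iff_eq]

/-- A cochain concentrated in degree `j` which vanishes on boundaries is a cocycle below `j`. -/
theorem δ_single_v_eq_zero {n' n : ℤ} (hn : n' + 1 = n) {j p : ℤ} (hp : j + n' = p)
    (ψ : M.X j ⟶ D.X p) (hψ : ∀ x, ψ.hom ((M.d (j - 1) j).hom x) = 0) (k q : ℤ) (hq : k + n = q)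
    (hk : k < j) : (δ n' n (Cochain.single (L := D) ψ n')).v k q hq = 0 := by
  have hψ' : ∀ k, k + 1 = j → ∀ x, ψ.hom ((M.d k j).hom x) = 0 := by
    rintro k hk x
    obtain rfl : k = j - 1 := by omega
    exact hψ x
  ext x
  rw [δ_v_apply hn _ k q (k + 1) (k + n') hq rfl rfl (by omega),
    Cochain.single_v_eq_zero _ _ _ _ _ hk.ne]
  by_cases hk' : k + 1 = j
  · subst hk'
    obtain rfl : p = q := by omega
    simp [Cochain.single_v, hψ']
  · rw [Cochain.single_v_eq_zero _ _ _ _ _ hk']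
    simp

variable (hD : ∀ n, Injective (D.X n))

include hD in
/-- A cochain vanishing below degree `j` whose component in degree `j` vanishes on cocycles is,
up to degree `j`, a coboundary. -/
theorem exists_cobound_of_vanish_on_cocycles {n' n : ℤ} (hn : n' + 1 = n) (j : ℤ)
    (ε : Cochain M D n) (h0 : ∀ k q hq, k < j → ε.v k q hq = 0)
    (h1 : ∀ q l hq (x : M.X j), j + 1 = l → (M.d j l).hom x = 0 → (ε.v j q hq).hom x = 0) :
    ∃ h : Cochain M D n', (∀ k q hq, k ≤ j → h.v k q hq = 0) ∧
      ∀ k q hq, k ≤ j → (ε - δ n' n h).v k q hq = 0 := by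
  obtain ⟨ξ, hξ⟩ := exists_factor (hD (j + n)) (M.d j (j + 1)).hom (ε.v j (j + n) rfl).hom
    (fun x hx => h1 _ _ _ x rfl hx)
  have hh : ∀ k q hq, k ≤ j → (Cochain.single (L := D)
      (((n.negOnePow : ℤˣ) : ℤ) • ModuleCat.ofHom ξ) n').v k q hq = 0 := fun k q hq hk =>
    Cochain.single_v_eq_zero _ _ _ _ _ (by omega)
  refine ⟨_, hh, fun k q hq hk => ?_⟩
  ext x
  have hd := δ_v_apply hn (Cochain.single (L := D)
      (((n.negOnePow : ℤˣ) : ℤ) • ModuleCat.ofHom ξ) n') k q (k + 1) (k + n') hq rfl rfl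
      (by omega) x
  rw [hh _ _ _ hk] at hd
  rw [Cochain.sub_v, ModuleCat.hom_sub, LinearMap.sub_apply, hd]
  rcases hk.lt_or_eq with hk | rfl
  · rw [hh _ _ _ (by omega), h0 _ _ _ hk]
    simp
  · obtain rfl := hq
    rw [Cochain.single_v]
    have := LinearMap.congr_fun hξ x
    simp only [LinearMap.comp_apply] at this
    have h2 : ((n.negOnePow : ℤˣ) : ℤ) * ((n.negOnePow : ℤˣ) : ℤ) = 1 := by
      rw [← Units.val_mul, ← Int.negOnePow_add, Int.negOnePow_even _ ⟨n, rfl⟩]; rfl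
    simp [this, smul_smul, h2]

include hD in
/-- The obstruction to solving `δ h = ε` one degree further is the class of `ε_j` in
`Ext^(j+n)(H^j(M), D)`; if it is annihilated by `t ∈ S`, the equation can be solved for `t • ε`. -/
theorem exists_cobound_succ {n' n m : ℤ} (hn : n' + 1 = n) (hm : n + 1 = m) (j : ℤ)
    (ht : ExtTors S D (M.homology j) (j + n))
    (ε : Cochain M D n) (h0 : ∀ k q hq, k < j → ε.v k q hq = 0)
    (h1 : ∀ k q hq, k ≤ j → (δ n m ε).v k q hq = 0) :
    ∃ t ∈ S, ∃ h : Cochain M D n', (∀ k q hq, k < j → h.v k q hq = 0) ∧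
      ∀ k q hq, k ≤ j → (t • ε - δ n' n h).v k q hq = 0 := by
  -- the component of `ε` in degree `j` induces a cocycle on homology
  have hB : ∀ x, (ε.v j (j + n) rfl).hom ((M.d (j - 1) j).hom x) = 0 := by
    intro x
    have := δ_v_apply hm ε (j - 1) (j + n) j (j - 1 + n) (by omega) (by omega) rfl rfl x
    rw [h1 _ _ _ (by omega), h0 _ _ _ (by omega)] at this
    simpa [isUnit_negOnePow_smul] using this.symm
  have hZ : ∀ l x, j + 1 = l → (M.d j l).hom x = 0 →
      (D.d (j + n) (j + m)).hom ((ε.v j (j + n) rfl).hom x) = 0 := by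
    rintro l x hl hx
    have := δ_v_apply hm ε j (j + m) l (j + n) rfl hl rfl (by omega) x
    rw [h1 _ _ _ (by omega), hx] at this
    simpa using this.symm
  obtain ⟨f, hf⟩ := exists_descent_of_ker (homologyClass_surjective M j (j + 1) rfl)
    ((ε.v j (j + n) rfl).hom ∘ₗ (LinearMap.ker (M.d j (j + 1)).hom).subtype) (by
      intro x hx
      obtain ⟨y, hy⟩ := (homologyClass_eq_zero_iff M (j - 1) j (j + 1) (by omega) rfl x).1 hx
      simp [← hy, hB])
  obtain ⟨t, htS, g, hg⟩ := ht (j + n') (j + m) (by omega) (by omega) f (fun x => by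
    obtain ⟨z, rfl⟩ := homologyClass_surjective M j (j + 1) rfl x
    rw [hf]
    exact hZ _ _ rfl z.2)
  obtain ⟨ψ, hψ⟩ := exists_extension (hD (j + n')) (LinearMap.ker (M.d j (j + 1)).hom).subtype
    Subtype.coe_injective (g ∘ₗ homologyClass M j (j + 1) rfl)
  have hψ' : ∀ x : LinearMap.ker (M.d j (j + 1)).hom, ψ x = g (homologyClass M j _ rfl x) :=
    fun x => LinearMap.congr_fun hψ x
  have hψB : ∀ x, ψ ((M.d (j - 1) j).hom x) = 0 := by
    intro x
    have := hψ' ⟨(M.d (j - 1) j).hom x, by simp⟩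
    rw [(homologyClass_eq_zero_iff M (j - 1) j (j + 1) (by omega) rfl _).2 ⟨x, rfl⟩] at this
    simpa using this
  set h₁ : Cochain M D n' := Cochain.single (ModuleCat.ofHom ψ) n' with hh₁
  have hv : ∀ k q hq, k ≠ j → h₁.v k q hq = 0 := fun k q hq hk =>
    Cochain.single_v_eq_zero _ _ _ _ _ hk
  obtain ⟨h₂, hh₂, hε⟩ := exists_cobound_of_vanish_on_cocycles hD hn j (t • ε - δ n' n h₁)
    (fun k q hq hk => by
      rw [Cochain.sub_v, Cochain.smul_v, h0 _ _ _ hk,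
        show (δ n' n h₁).v k q hq = 0 from
          δ_single_v_eq_zero hn rfl (ModuleCat.ofHom ψ) hψB k q hq hk]
      simp)
    (by
      rintro q l rfl x hl hx
      rw [Cochain.sub_v, Cochain.smul_v, ModuleCat.hom_sub, LinearMap.sub_apply,
        δ_v_apply hn h₁ j (j + n) l (j + n') rfl hl rfl (by omega), hx, hh₁, Cochain.single_v]
      obtain rfl := hl
      have h3 := hg (homologyClass M j _ rfl ⟨x, hx⟩)
      rw [hf, ← hψ'] at h3
      have h4 : t • (ε.v j (j + n) rfl).hom x = (D.d (j + n') (j + n)).hom (ψ x) := h3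
      simp [h4])
  refine ⟨t, htS, h₁ + h₂, fun k q hq hk => ?_, fun k q hq hk => ?_⟩
  · rw [Cochain.add_v, hv _ _ _ hk.ne, hh₂ _ _ _ hk.le, add_zero]
  · have := hε k q hq hk
    rwa [sub_sub, ← δ_add] at this

include hD in
/-- A cochain which is a cocycle below degree `j₁` and vanishes below degree `j₀` becomes, after
multiplication by an element of `S`, a coboundary below degree `j₁`, as soon as the obstructions,
which are classes in `Ext^(k+n)(H^k(M), D)`, are `S`-torsion. -/
theorem exists_cobound_lt {n' n m : ℤ} (hn : n' + 1 = n) (hm : n + 1 = m) {j₀ j₁ : ℤ}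
    (hj : j₀ ≤ j₁) (ht : ∀ k, j₀ ≤ k → k < j₁ → ExtTors S D (M.homology k) (k + n))
    (γ : Cochain M D n) (h0 : ∀ k q hq, k < j₀ → γ.v k q hq = 0)
    (h1 : ∀ k q hq, k < j₁ → (δ n m γ).v k q hq = 0) :
    ∃ t ∈ S, ∃ h : Cochain M D n', (∀ k q hq, k < j₀ → h.v k q hq = 0) ∧
      ∀ k q hq, k < j₁ → (t • γ - δ n' n h).v k q hq = 0 := by
  induction j₁, hj using Int.leInduction with
  | base => exact ⟨1, S.one_mem, 0, fun _ _ _ _ => rfl, fun k q hq hk => by simp [h0 _ _ _ hk]⟩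
  | succ j hj ih =>
    obtain ⟨t, htS, h, hh, hγ⟩ := ih (fun k hk hk' => ht k hk (by omega))
      (fun k q hq hk => h1 k q hq (by omega))
    obtain ⟨s, hsS, u, hu, hγ'⟩ := exists_cobound_succ hD hn hm j (ht j hj (by omega))
      (t • γ - δ n' n h) hγ (fun k q hq hk => by
        rw [δ_sub, δ_smul, δ_δ, sub_zero, Cochain.smul_v, h1 k q hq (by omega), smul_zero])
    refine ⟨s * t, S.mul_mem hsS htS, s • h + u, fun k q hq hk => ?_, fun k q hq hk => ?_⟩
    · rw [Cochain.add_v, Cochain.smul_v, hh _ _ _ hk, hu _ _ _ (by omega)]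
      simp
    · have := hγ' k q hq (by omega)
      rwa [smul_sub, sub_sub, ← δ_smul, ← δ_add, smul_smul] at this

variable {a b : ℤ} (hab : ∀ n : ℤ, (n < a ∨ b < n) → Limits.IsZero (D.X n))

include hD hab in
/-- If `D` is bounded, solving `δ h = t • γ` in finitely many degrees solves it. -/
theorem exists_cobound {n' n m : ℤ} (hn : n' + 1 = n) (hm : n + 1 = m) {j₀ : ℤ}
    (ht : ∀ k, j₀ ≤ k → ExtTors S D (M.homology k) (k + n))
    (γ : Cochain M D n) (h0 : ∀ k q hq, k < j₀ → γ.v k q hq = 0) (h1 : δ n m γ = 0) :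
    ∃ t ∈ S, ∃ h : Cochain M D n', (∀ k q hq, k < j₀ → h.v k q hq = 0) ∧ t • γ = δ n' n h := by
  obtain ⟨t, htS, h, hh, hγ⟩ := exists_cobound_lt (S := S) hD hn hm
    (le_max_left j₀ (b - n + 1)) (fun k hk _ => ht k hk) γ h0 (fun k q hq hk => by rw [h1]; rfl)
  refine ⟨t, htS, h, hh, ?_⟩
  rw [← sub_eq_zero]
  ext1 k q hq
  rcases lt_or_ge k (max j₀ (b - n + 1)) with hk | hk
  · exact hγ k q hq hk
  · exact (hab q (Or.inr (by have := le_trans (le_max_right _ _) hk; omega))).eq_of_tgt _ _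

include hD hab in
/-- If `Ext^(k+n)(H^k(M), D)` is `S`-torsion for all `k`, then so is `Hⁿ(RHom(M, D))`. -/
theorem exists_smul_eq_δ {n' n m : ℤ} (hn : n' + 1 = n) (hm : n + 1 = m)
    (ht : ∀ k, ExtTors S D (M.homology k) (k + n))
    (γ : Cochain M D n) (h1 : δ n m γ = 0) :
    ∃ t ∈ S, ∃ h : Cochain M D n', t • γ = δ n' n h := by
  obtain ⟨t, htS, h, -, hγ⟩ := exists_cobound (S := S) hD hab hn hm (j₀ := a - n)
    (fun k _ => ht k) γ
    (fun k q hq hk => (hab q (Or.inl (by omega))).eq_of_tgt _ _) h1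
  exact ⟨t, htS, h, hγ⟩

include hD hab in
/-- The corner of the spectral sequence `Ext^q(H^p(M), D) ⇒ H^(q-p)(RHom(M, D))`: if the classes
in `Ext^i(H^j(M), D)` are not all `S`-torsion, and all potential differentials into and out of
that spot are `S`-torsion, then `H^(i-j)(RHom(M, D))` is not `S`-torsion. -/
theorem exists_cocycle_not_tors {i j n' n m : ℤ} (hij : j + n = i) (hn : n' + 1 = n)
    (hm : n + 1 = m) (hf : ¬ ExtTors S D (M.homology j) i)
    (hlt : ∀ k, k < j → ExtTors S D (M.homology k) (k + n'))
    (hgt : ∀ k, j < k → ExtTors S D (M.homology k) (k + m)) :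
    ∃ γ : Cochain M D n, δ n m γ = 0 ∧ ∀ t ∈ S, ∀ h : Cochain M D n', t • γ ≠ δ n' n h := by
  subst hij
  simp only [ExtTors, not_forall] at hf
  obtain ⟨i', i'', hi', hi'', f, hdf, hf⟩ := hf
  obtain rfl : i' = j + n' := by omega
  obtain rfl : i'' = j + m := by omega
  obtain ⟨ψ, hψ⟩ := exists_extension (hD (j + n)) (LinearMap.ker (M.d j (j + 1)).hom).subtype
    Subtype.coe_injective (f ∘ₗ homologyClass M j (j + 1) rfl)
  have hψ' : ∀ x : LinearMap.ker (M.d j (j + 1)).hom, ψ x = f (homologyClass M j _ rfl x) :=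
    fun x => LinearMap.congr_fun hψ x
  have hψB : ∀ x, ψ ((M.d (j - 1) j).hom x) = 0 := by
    intro x
    have := hψ' ⟨(M.d (j - 1) j).hom x, by simp⟩
    rw [(homologyClass_eq_zero_iff M (j - 1) j (j + 1) (by omega) rfl _).2 ⟨x, rfl⟩] at this
    simpa using this
  have hvB (k q : ℤ) (hq : k + m = q) (hk : k < j) :=
    δ_single_v_eq_zero hm rfl (ModuleCat.ofHom ψ) hψB k q hq hk
  obtain ⟨g₀, hg₀⟩ : ∃ g₀ : Cochain M D n, g₀ = Cochain.single (ModuleCat.ofHom ψ) n := ⟨_, rfl⟩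
  rw [← hg₀] at hvB
  have hg₀j : g₀.v j (j + n) rfl = ModuleCat.ofHom ψ := by rw [hg₀, Cochain.single_v]
  have hg₀k (k q : ℤ) (hq : k + n = q) (hk : k ≠ j) : g₀.v k q hq = 0 := by
    rw [hg₀, Cochain.single_v_eq_zero _ _ _ _ _ hk]
  -- extend the class to a cocycle, killing the obstructions above degree `j`
  obtain ⟨h₀, hh₀, hε⟩ := exists_cobound_of_vanish_on_cocycles hD hm j (δ n m g₀) hvB
    (by
      rintro q l rfl x hl hx
      rw [δ_v_apply hm g₀ j (j + m) l (j + n) rfl hl rfl (by omega), hx, hg₀j]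
      have := hψ' ⟨x, by subst hl; exact hx⟩
      simp only at this
      simp [this, hdf])
  obtain ⟨s, hsS, h₁, hh₁, hsε⟩ := exists_cobound (S := S) hD hab hm (j₀ := j + 1) rfl
    (fun k hk => hgt k (by omega)) (δ n m g₀ - δ n m h₀) (fun k q hq hk => hε k q hq (by omega))
    (by simp [δ_δ])
  refine ⟨s • g₀ - s • h₀ - h₁, by simp [← hsε, smul_sub], fun t htS h hth => hf ?_⟩
  have hγ (k q : ℤ) (hq : k + n = q) (hk : k ≤ j) :
      (s • g₀ - s • h₀ - h₁).v k q hq = s • g₀.v k q hq := by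
    simp [hh₀ k q hq hk, hh₁ k q hq (by omega)]
  -- modify the primitive `h` so that it vanishes below degree `j`
  obtain ⟨t', ht'S, u, -, hu⟩ := exists_cobound_lt (S := S) hD
    (show n' - 1 + 1 = n' by omega) hn (min_le_right (a - n') j)
    (fun k _ hk => hlt k hk) h
    (fun k q hq hk => (hab q (Or.inl (by
      have := lt_of_lt_of_le hk (min_le_left _ _); omega))).eq_of_tgt _ _)
    (fun k q hq hk => by
      rw [← hth, Cochain.smul_v, hγ k q hq hk.le, hg₀k k q hq hk.ne]; simp)
  obtain ⟨w, hw⟩ : ∃ w, w = t' • h - δ (n' - 1) n' u := ⟨_, rfl⟩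
  rw [← hw] at hu
  have hδw : δ n' n w = (t' * t) • (s • g₀ - s • h₀ - h₁) := by
    rw [hw, δ_sub, δ_smul, δ_δ, sub_zero, ← hth, smul_smul]
  have hwB : ∀ x, (w.v j (j + n') rfl).hom ((M.d (j - 1) j).hom x) = 0 := by
    intro x
    have := δ_v_apply hn w (j - 1) (j + n') j (j - 1 + n') (by omega) (by omega) rfl rfl x
    rw [hu _ _ _ (by omega), hδw, Cochain.smul_v, hγ _ _ _ (by omega),
      hg₀k _ _ _ (by omega)] at this
    simpa [isUnit_negOnePow_smul] using this.symm
  obtain ⟨f', hf'⟩ := exists_descent_of_ker (homologyClass_surjective M j (j + 1) rfl)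
    ((w.v j (j + n') rfl).hom ∘ₗ (LinearMap.ker (M.d j (j + 1)).hom).subtype) (by
      intro x hx
      obtain ⟨y, hy⟩ := (homologyClass_eq_zero_iff M (j - 1) j (j + 1) (by omega) rfl x).1 hx
      simp [← hy, hwB])
  refine ⟨t' * t * s, S.mul_mem (S.mul_mem ht'S htS) hsS, f', fun y => ?_⟩
  obtain ⟨x, rfl⟩ := homologyClass_surjective M j (j + 1) rfl y
  rw [hf', ← hψ']
  have := δ_v_apply hn w j (j + n) (j + 1) (j + n') rfl rfl rfl (by omega) x
  rw [x.2, hδw, Cochain.smul_v, hγ _ _ _ le_rfl, hg₀j] at this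
  simpa [mul_smul] using this

end Core

/-! ### The complex `Hom(T, D)` -/

section HomFrom

/-- The complex `Hom_R(T, D)` for an `R`-module `T`, with differential `f ↦ d ∘ f`. -/
def homFrom (T : Type u) [AddCommGroup T] [Module R T] (D : ModComplex R) : ModComplex R where
  X n := ModuleCat.of R (T →ₗ[R] D.X n)
  d i j := ModuleCat.ofHom (LinearMap.llcomp R T (D.X i) (D.X j) (D.d i j).hom)
  shape i j h := by
    ext f x
    simp [D.shape i j h]
  d_comp_d' i j k _ _ := by
    ext f x
    simp

variable {D : ModComplex R} {T T' : Type u} [AddCommGroup T] [Module R T] [AddCommGroup T']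
  [Module R T']

/-- An element of degree `n` of `Hom_R(T, D)`, seen as a linear map `T → Dⁿ`. -/
abbrev homFrom.toHom {n : ℤ} (f : (homFrom T D).X n) : T →ₗ[R] D.X n := f

theorem homFrom_d_eq_zero_iff (i j : ℤ) (f : T →ₗ[R] D.X i) :
    ((homFrom T D).d i j).hom f = 0 ↔ ∀ x, (D.d i j).hom (f x) = 0 := by
  constructor
  · intro h x
    exact LinearMap.congr_fun (h : (((homFrom T D).d i j).hom f : T →ₗ[R] D.X j) = 0) x
  · intro h
    exact LinearMap.ext h

theorem extTors_iff (S : Submonoid R) (n : ℤ) :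
    ExtTors S D T n ↔ ∀ y : (homFrom T D).homology n, ∃ s ∈ S, s • y = 0 := by
  constructor
  · intro h y
    obtain ⟨f, rfl⟩ := homologyClass_surjective _ n (n + 1) rfl y
    obtain ⟨s, hs, g, hg⟩ := h (n - 1) (n + 1) (by omega) rfl f.1
      ((homFrom_d_eq_zero_iff _ _ f.1).1 f.2)
    refine ⟨s, hs, ?_⟩
    rw [← map_smul, homologyClass_eq_zero_iff _ (n - 1) n (n + 1) (by omega)]
    exact ⟨g, LinearMap.ext fun x => (hg x).symm⟩
  · rintro h a c ha rfl f hf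
    obtain ⟨s, hs, h'⟩ := h (homologyClass _ n (n + 1) rfl
      ⟨f, (homFrom_d_eq_zero_iff _ _ f).2 hf⟩)
    rw [← map_smul, homologyClass_eq_zero_iff _ a n (n + 1) ha] at h'
    obtain ⟨g, hg⟩ := h'
    exact ⟨s, hs, g, fun x => (LinearMap.congr_fun hg x).symm⟩

theorem fg_range_of_ker_le {L A B : Type*} [AddCommGroup L] [Module R L] [AddCommGroup A]
    [Module R A] [AddCommGroup B] [Module R B] [IsNoetherian R A] (α : L →ₗ[R] A) (β : L →ₗ[R] B)
    (h : LinearMap.ker α ≤ LinearMap.ker β) : (LinearMap.range β).FG := by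
  have : Module.Finite R (L ⧸ LinearMap.ker α) :=
    Module.Finite.of_injective ((LinearMap.ker α).liftQ α le_rfl)
      (LinearMap.ker_eq_bot.1 (Submodule.ker_liftQ_eq_bot _ _ _ le_rfl))
  rw [← Submodule.range_liftQ (LinearMap.ker α) β h, ← Module.Finite.iff_fg]
  infer_instance

/-- The inductive step for finite generation of `Extⁿ(T, D)`: if `T` is a quotient of a finite free
module with kernel `K`, then a class in `Extⁿ(T, D)` is determined by its values on the generators,
which lie in `Hⁿ(D)`, up to the image of `Extⁿ⁻¹(K, D)`. -/
theorem finite_homology_homFrom_step [IsNoetherianRing R] (hD : ∀ n, Injective (D.X n))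
    {a n : ℤ} (ha : a + 1 = n) [Module.Finite R (D.homology n)] {m : ℕ}
    (q : (Fin m → R) →ₗ[R] T) (hq : Function.Surjective q)
    [Module.Finite R ((homFrom (LinearMap.ker q) D).homology a)] :
    Module.Finite R ((homFrom T D).homology n) := by
  let cT := homologyClass (homFrom T D) n (n + 1) rfl
  -- pairs of a cocycle on `T` and a primitive of its pullback to the free module
  let L : Submodule R (((Fin m → R) →ₗ[R] D.X a) × (T →ₗ[R] D.X n)) :=
    { carrier := {z | ∀ x, z.2 (q x) = (D.d a n).hom (z.1 x)}
      add_mem' := fun {y z} hy hz x => by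
        have h1 := hy x
        have h2 := hz x
        simp [h1, h2]
      zero_mem' := fun x => by simp
      smul_mem' := fun r z hz x => by
        have h1 := hz x
        simp [h1] }
  let β : L →ₗ[R] (homFrom T D).homology n := cT ∘ₗ
    LinearMap.codRestrict (LinearMap.ker ((homFrom T D).d n (n + 1)).hom)
      (LinearMap.snd R _ _ ∘ₗ L.subtype) (fun z =>
        (homFrom_d_eq_zero_iff n (n + 1) z.1.2).2 fun x => by
          obtain ⟨y, rfl⟩ := hq x
          simp [z.2 y])
  let α : L →ₗ[R] (homFrom (LinearMap.ker q) D).homology a :=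
    homologyClass (homFrom (LinearMap.ker q) D) a n ha ∘ₗ
    LinearMap.codRestrict (LinearMap.ker ((homFrom (LinearMap.ker q) D).d a n).hom)
      (LinearMap.lcomp R (D.X a) (LinearMap.ker q).subtype ∘ₗ LinearMap.fst R _ _ ∘ₗ L.subtype)
      (fun z => (homFrom_d_eq_zero_iff a n (z.1.1 ∘ₗ (LinearMap.ker q).subtype)).2 fun x => by
          have h1 := z.2 x
          have h2 := x.2
          rw [LinearMap.mem_ker] at h2
          simpa [h2] using h1.symm)
  have hβ : (LinearMap.range β).FG := by
    refine fg_range_of_ker_le α β fun z hz => ?_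
    obtain ⟨u, hu⟩ := (homologyClass_eq_zero_iff _ (a - 1) a n (by omega) ha _).1 hz
    obtain ⟨v, hv⟩ := exists_extension (hD (a - 1)) (LinearMap.ker q).subtype
      Subtype.coe_injective u
    obtain ⟨w, hw⟩ := exists_descent_of_ker hq (z.1.1 - (D.d (a - 1) a).hom ∘ₗ v) (fun x hx => by
      have h1 : v x = homFrom.toHom u ⟨x, hx⟩ := LinearMap.congr_fun hv ⟨x, hx⟩
      have h2 : (D.d (a - 1) a).hom (homFrom.toHom u ⟨x, hx⟩) = z.1.1 x :=
        LinearMap.congr_fun hu ⟨x, hx⟩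
      simp [h1, h2])
    refine (homologyClass_eq_zero_iff (homFrom T D) a n (n + 1) ha rfl _).2
      ⟨w, LinearMap.ext fun x => ?_⟩
    obtain ⟨y, rfl⟩ := hq x
    change (D.d a n).hom (w (q y)) = z.1.2 (q y)
    rw [z.2 y, hw]
    simp
  have : Module.Finite R (LinearMap.range β) := Module.Finite.iff_fg.2 hβ
  -- the values on the generators
  let gen : Fin m → T := fun i => q (Pi.single i 1)
  let θ : LinearMap.ker ((homFrom T D).d n (n + 1)).hom →ₗ[R] (Fin m → D.homology n) :=
    LinearMap.pi fun i => homologyClass D n (n + 1) rfl ∘ₗ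
      LinearMap.codRestrict (LinearMap.ker (D.d n (n + 1)).hom)
        (LinearMap.applyₗ (R := R) (M₂ := D.X n) (gen i) ∘ₗ Submodule.subtype _)
        (fun f => (homFrom_d_eq_zero_iff n (n + 1) f.1).1 f.2 _)
  have hθ : LinearMap.ker θ ≤ LinearMap.ker ((LinearMap.range β).mkQ ∘ₗ cT) := by
    intro f hf
    have h1 : ∀ i, ∃ g : D.X a, (D.d a n).hom g = homFrom.toHom f.1 (gen i) := fun i =>
      (homologyClass_eq_zero_iff D a n (n + 1) ha rfl _).1 (congrFun hf i)
    choose g hg using h1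
    rw [LinearMap.mem_ker, LinearMap.comp_apply, Submodule.mkQ_apply,
      Submodule.Quotient.mk_eq_zero]
    have hL : ((Fintype.linearCombination R g, f.1) :
        ((Fin m → R) →ₗ[R] D.X a) × (T →ₗ[R] D.X n)) ∈ L := by
      intro x
      have : ∀ x, (homFrom.toHom f.1 ∘ₗ q) x =
          ((D.d a n).hom ∘ₗ Fintype.linearCombination R g) x := by
        refine LinearMap.congr_fun (LinearMap.pi_ext' fun i => LinearMap.ext_ring ?_)
        simp [hg, gen]
      exact this x
    exact ⟨⟨_, hL⟩, rfl⟩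
  have hfin : (LinearMap.range ((LinearMap.range β).mkQ ∘ₗ cT)).FG := fg_range_of_ker_le θ _ hθ
  have : Module.Finite R ((homFrom T D).homology n ⧸ LinearMap.range β) := by
    have hsurj : Function.Surjective ((LinearMap.range β).mkQ ∘ₗ cT) :=
      (Submodule.mkQ_surjective _).comp (homologyClass_surjective (homFrom T D) n (n + 1) rfl)
    rw [LinearMap.range_eq_top.2 hsurj] at hfin
    exact ⟨hfin⟩
  exact Module.Finite.of_submodule_quotient (LinearMap.range β)

/-- If `D` is a complex of injective modules, bounded below, with finitely generated homology, then
`Extⁿ(T, D)` is finitely generated for every finitely generated module `T`. -/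
theorem finite_homology_homFrom [IsNoetherianRing R] (hD : ∀ n, Injective (D.X n))
    (hfin : ∀ n, Module.Finite R (D.homology n)) {a : ℤ} (ha : ∀ n < a, Limits.IsZero (D.X n))
    (n : ℤ) (T : Type u) [AddCommGroup T] [Module R T] [Module.Finite R T] :
    Module.Finite R ((homFrom T D).homology n) := by
  rcases lt_or_ge n a with hn | hn
  · have : Subsingleton ((homFrom T D).homology n) := by
      have h1 := ModuleCat.subsingleton_of_isZero (ha n hn)
      have h2 : Subsingleton ((homFrom T D).X n) :=
        inferInstanceAs (Subsingleton (T →ₗ[R] D.X n))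
      exact (homologyClass_surjective (homFrom T D) n (n + 1) rfl).subsingleton
    infer_instance
  · have key : ∀ n, a - 1 ≤ n → ∀ (T : Type u) [AddCommGroup T] [Module R T] [Module.Finite R T],
        Module.Finite R ((homFrom T D).homology n) := by
      intro n hn
      induction n, hn using Int.leInduction with
      | base =>
        intro T _ _ _
        have h1 := ModuleCat.subsingleton_of_isZero (ha (a - 1) (by omega))
        have h2 : Subsingleton ((homFrom T D).X (a - 1)) :=
          inferInstanceAs (Subsingleton (T →ₗ[R] D.X (a - 1)))
        have : Subsingleton ((homFrom T D).homology (a - 1)) :=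
          (homologyClass_surjective (homFrom T D) (a - 1) _ rfl).subsingleton
        infer_instance
      | succ n hn ih =>
        intro T _ _ _
        obtain ⟨m, q, hq⟩ := Module.Finite.exists_fin' R T
        have := ih (LinearMap.ker q)
        exact finite_homology_homFrom_step hD rfl q hq
    exact key n (by omega) T

end HomFrom

/-! ### Dévissage -/

section Devissage

variable {D : ModComplex R} (hD : ∀ n, Injective (D.X n))

theorem forall_smul_eq_zero_iff_mem {N : Type*} [AddCommGroup N] [Module R N] {I : Ideal R}
    (e : N ≃ₗ[R] R ⧸ I) (r : R) : (∀ x : N, r • x = 0) ↔ r ∈ I := by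
  constructor
  · intro h
    have := congrArg e (h (e.symm 1))
    rw [map_smul, e.apply_symm_apply, map_zero, Algebra.smul_def, mul_one] at this
    exact Ideal.Quotient.eq_zero_iff_mem.1 this
  · intro hr x
    apply e.injective
    rw [map_smul, map_zero, Algebra.smul_def]
    have : algebraMap R (R ⧸ I) r = 0 := Ideal.Quotient.eq_zero_iff_mem.2 hr
    rw [this, zero_mul]

include hD in
/-- Dévissage along a prime filtration. -/
theorem ExtTors.of_primes [IsNoetherianRing R] {p : PrimeSpectrum R} (I : Ideal R) {n : ℤ}
    (h : ∀ q : PrimeSpectrum R, I ≤ q.asIdeal → q ≤ p →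
      ExtTors p.asIdeal.primeCompl D (R ⧸ q.asIdeal) n)
    (T : Type u) [AddCommGroup T] [Module R T] [hT : Module.Finite R T]
    (hI : ∀ r ∈ I, ∀ x : T, r • x = 0) : ExtTors p.asIdeal.primeCompl D T n := by
  induction hT using IsNoetherianRing.induction_on_isQuotientEquivQuotientPrime R with
  | subsingleton N =>
    exact ExtTors.of_smul_eq_zero n (Submonoid.one_mem _) fun x => Subsingleton.elim _ _
  | quotient N q e =>
    have hann := forall_smul_eq_zero_iff_mem e
    by_cases hqp : q ≤ p
    · exact (h q (fun r hr => (hann r).1 (hI r hr)) hqp).of_linearEquiv e.symm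
    · obtain ⟨s, hsq, hsp⟩ := SetLike.not_le_iff_exists.1
        (show ¬ q.asIdeal ≤ p.asIdeal from hqp)
      exact ExtTors.of_smul_eq_zero n hsp ((hann s).2 hsq)
  | exact N₁ N₂ N₃ i q hi hq hiq h₁ h₃ =>
    refine ExtTors.middle hD hi hq hiq (h₁ fun r hr x => hi ?_) (h₃ fun r hr x => ?_)
    · rw [map_smul, hI r hr, map_zero]
    · obtain ⟨y, rfl⟩ := hq x
      rw [← map_smul, hI r hr, map_zero]

theorem exists_mem_forall_smul_mem {N : Type*} [AddCommGroup N] [Module R N] [Module.Finite R N]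
    (S : Submonoid R) (W : Submodule R N) (h : ∀ x : N, ∃ s ∈ S, s • x ∈ W) :
    ∃ s ∈ S, ∀ x : N, s • x ∈ W := by
  classical
  obtain ⟨G, hG⟩ := (Module.Finite.fg_top : (⊤ : Submodule R N).FG)
  choose s hs hsW using h
  refine ⟨∏ g ∈ G, s g, Submonoid.prod_mem _ fun g _ => hs g, fun x => ?_⟩
  have hx : x ∈ Submodule.span R (G : Set N) := hG ▸ Submodule.mem_top
  induction hx using Submodule.span_induction with
  | mem y hy =>
    rw [← Finset.prod_erase_mul _ _ (Finset.mem_coe.1 hy), mul_smul]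
    exact W.smul_mem _ (hsW y)
  | zero => simp
  | add y z _ _ hy hz => rw [smul_add]; exact W.add_mem hy hz
  | smul r y _ hy => rw [smul_comm]; exact W.smul_mem _ hy

/-- Nakayama's lemma localized at a prime, without passing to the local ring. -/
theorem exists_smul_eq_zero_of_smul_mem {N : Type*} [AddCommGroup N] [Module R N]
    [Module.Finite R N] (p : Ideal R) [p.IsPrime] {r : R} (hr : r ∈ p)
    (h : ∀ x : N, ∃ s ∈ p.primeCompl, ∃ y : N, s • x = r • y) :
    ∃ s ∈ p.primeCompl, ∀ x : N, s • x = 0 := by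
  obtain ⟨s, hs, hsN⟩ := exists_mem_forall_smul_mem p.primeCompl
    (LinearMap.range (LinearMap.lsmul R N r)) (fun x => by
      obtain ⟨s, hs, y, hy⟩ := h x
      exact ⟨s, hs, y, hy.symm⟩)
  obtain ⟨P, hP, -, hcoeff, hzero⟩ :=
    LinearMap.exists_monic_and_natDegree_eq_and_coeff_mem_pow_and_aeval_eq_zero R
      (algebraMap R (Module.End R N) s) (Ideal.span {r}) (by
        rintro _ ⟨x, rfl⟩
        obtain ⟨y, hy⟩ := hsN x
        change s • x ∈ _
        rw [← hy]
        exact Submodule.smul_mem_smul (Ideal.mem_span_singleton_self r) Submodule.mem_top)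
  refine ⟨P.eval s, ?_, fun x => ?_⟩
  · intro hmem
    have h1 : P.eval s = s ^ P.natDegree +
        ∑ i ∈ Finset.range P.natDegree, P.coeff i * s ^ i := by
      conv_lhs => rw [hP.as_sum]
      simp [Polynomial.eval_finsetSum]
    have h2 : ∑ i ∈ Finset.range P.natDegree, P.coeff i * s ^ i ∈ p := by
      refine p.sum_mem fun i hi => p.mul_mem_right _ ?_
      have h3 := Ideal.pow_le_self (I := Ideal.span {r})
        (n := P.natDegree - i) (by have := Finset.mem_range.1 hi; omega) (hcoeff i)
      exact (Ideal.span_singleton_le_iff_mem p).2 hr h3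
    rw [h1] at hmem
    exact hs (Ideal.IsPrime.mem_of_pow_mem ‹_› _ ((p.add_mem_iff_left h2).1 hmem))
  · rw [Polynomial.aeval_algebraMap_apply] at hzero
    have := LinearMap.congr_fun hzero x
    simpa using this

include hD in
/-- If `r ∈ p` acts injectively on `T` and `Extⁿ⁺¹(T/rT, D)_p = 0`, then `Extⁿ(T, D)_p = 0`, by
Nakayama's lemma. -/
theorem ExtTors.of_quotient {p : Ideal R} [p.IsPrime] {r : R} (hr : r ∈ p) {n m : ℤ}
    (hnm : n + 1 = m) {T : Type u} [AddCommGroup T] [Module R T]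
    [Module.Finite R ((homFrom T D).homology n)]
    (hinj : Function.Injective (LinearMap.lsmul R T r))
    (h : ExtTors p.primeCompl D (T ⧸ LinearMap.range (LinearMap.lsmul R T r)) m) :
    ExtTors p.primeCompl D T n := by
  rw [extTors_iff]
  suffices h : ∃ s ∈ p.primeCompl, ∀ x : (homFrom T D).homology n, s • x = 0 by
    obtain ⟨s, hs, h⟩ := h
    exact fun x => ⟨s, hs, h x⟩
  refine exists_smul_eq_zero_of_smul_mem p hr fun x => ?_
  obtain ⟨f, rfl⟩ := homologyClass_surjective _ n m hnm x
  have hf := (homFrom_d_eq_zero_iff n m f.1).1 f.2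
  obtain ⟨f₂, hf₂⟩ := exists_extension (hD n) _ hinj (homFrom.toHom f.1)
  have hf₂' : ∀ x, f₂ (r • x) = homFrom.toHom f.1 x := fun x => LinearMap.congr_fun hf₂ x
  obtain ⟨f₃, hf₃⟩ := exists_descent_of_ker
    (Submodule.mkQ_surjective (LinearMap.range (LinearMap.lsmul R T r)))
    ((D.d n m).hom ∘ₗ f₂) (fun x hx => by
      rw [Submodule.mkQ_apply, Submodule.Quotient.mk_eq_zero] at hx
      obtain ⟨y, rfl⟩ := hx
      change (D.d n m).hom (f₂ (r • y)) = 0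
      rw [hf₂']
      exact hf y)
  obtain ⟨s, hs, g, hg⟩ := h n (m + 1) hnm rfl f₃ (fun x => by
    obtain ⟨y, rfl⟩ := Submodule.mkQ_surjective _ x
    rw [hf₃]
    exact d_d_apply D n m (m + 1) _)
  let f₁ : T →ₗ[R] D.X n := s • f₂ - g ∘ₗ Submodule.mkQ _
  have hf₁ : ((homFrom T D).d n m).hom f₁ = 0 := by
    refine (homFrom_d_eq_zero_iff n m f₁).2 fun x => ?_
    have := hg (Submodule.mkQ _ x)
    rw [hf₃] at this
    simp only [f₁, LinearMap.sub_apply, LinearMap.smul_apply, map_sub, map_smul,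
      LinearMap.comp_apply, ← this, sub_self]
  refine ⟨s, hs, homologyClass _ n m hnm ⟨f₁, hf₁⟩, ?_⟩
  rw [← map_smul, ← map_smul]
  congr 1
  ext1
  refine LinearMap.ext fun x => ?_
  change s • homFrom.toHom f.1 x = r • f₁ x
  have hx : Submodule.mkQ (LinearMap.range (LinearMap.lsmul R T r)) (r • x) = 0 := by
    rw [Submodule.mkQ_apply, Submodule.Quotient.mk_eq_zero]
    exact ⟨x, rfl⟩
  rw [← map_smul f₁, LinearMap.sub_apply, LinearMap.comp_apply, hx, map_zero, sub_zero,
    LinearMap.smul_apply, hf₂']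

end Devissage

/-! ### Biduality -/

section Biduality

open CochainComplex.HomComplex

theorem homologyMap_homologyClass {K L : ModComplex R} (φ : K ⟶ L) (k l : ℤ) (hl : k + 1 = l)
    (x : LinearMap.ker (K.d k l).hom) (y : LinearMap.ker (L.d k l).hom)
    (hxy : (φ.f k).hom x = y) :
    (HomologicalComplex.homologyMap φ k).hom (homologyClass K k l hl x) =
      homologyClass L k l hl y := by
  have key : (HomologicalComplex.cyclesMap φ k).hom ((K.liftCycles (ModuleCat.ofHom
      (LinearMap.ker (K.d k l).hom).subtype) l (by simp [hl]) (by ext x; exact x.2)).hom x) =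
      (L.liftCycles (ModuleCat.ofHom (LinearMap.ker (L.d k l).hom).subtype) l
        (by simp [hl]) (by ext x; exact x.2)).hom y := by
    apply (ModuleCat.mono_iff_injective (L.iCycles k)).1 inferInstance
    rw [← ModuleCat.comp_apply, ← ModuleCat.comp_apply, ← ModuleCat.comp_apply,
      HomologicalComplex.cyclesMap_i, HomologicalComplex.liftCycles_i,
      HomologicalComplex.liftCycles_i_assoc]
    exact hxy
  have h (c) : (HomologicalComplex.homologyMap φ k).hom ((K.homologyπ k).hom c) =
      (L.homologyπ k).hom ((HomologicalComplex.cyclesMap φ k).hom c) := by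
    rw [← ModuleCat.comp_apply, HomologicalComplex.homologyπ_naturality]
    rfl
  exact (h _).trans (congrArg (L.homologyπ k).hom key)

section Dualizing

variable {D : ModComplex R} (hD : D.IsDualizing)

include hD

/-- The cohomology of `Hom(D, D)` vanishes in nonzero degrees. -/
theorem IsDualizing.exists_δ_eq {n' n m : ℤ} (hn' : n' + 1 = n) (hm : n + 1 = m) (hn : n ≠ 0)
    (z : Cochain D D n) (hz : δ n m z = 0) : ∃ u : Cochain D D n', δ n' n u = z := by
  have := hD.homothety_quasiIso
  have h0 := (HomologicalComplex.isZero_single_obj_homology (ComplexShape.up ℤ) 0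
    (ModuleCat.of R R) n hn).of_iso
    (isoOfQuasiIsoAt D.homothety n).symm
  have hs := ModuleCat.subsingleton_of_isZero h0
  exact (homologyClass_eq_zero_iff (homComplex D D) n' n m hn' hm ⟨z, hz⟩).1
    (Subsingleton.elim _ _)

omit hD in
theorem homothety_f_zero_apply (D : ModComplex R) (r : R) :
    (D.homothety.f 0).hom ((HomologicalComplex.singleObjXSelf (ComplexShape.up ℤ) 0
      (ModuleCat.of R R)).inv.hom r) = r • Cochain.ofHom (𝟙 D) := by
  obtain ⟨φ, h, hφ⟩ : ∃ φ : ModuleCat.of R R ⟶ (homComplex D D).X 0, D.homothety.f 0 =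
      (HomologicalComplex.singleObjXSelf (ComplexShape.up ℤ) 0 (ModuleCat.of R R)).hom ≫ φ ∧
      φ.hom r = r • Cochain.ofHom (𝟙 D) :=
    ⟨ModuleCat.ofHom (LinearMap.toSpanSingleton R (Cochain D D 0) (Cochain.ofHom (𝟙 D))),
      HomologicalComplex.mkHomFromSingle_f _ _, rfl⟩
  rw [← ModuleCat.comp_apply, h, Iso.inv_hom_id_assoc]
  exact hφ

/-- The homothety map `R → H⁰(Hom(D, D))` is surjective. -/
theorem IsDualizing.exists_smul_add_δ_eq (z : Cochain D D 0) (hz : δ 0 1 z = 0) :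
    ∃ (r : R) (u : Cochain D D (-1)), r • Cochain.ofHom (𝟙 D) + δ (-1) 0 u = z := by
  have := hD.homothety_quasiIso
  have hepi := (ModuleCat.epi_iff_surjective
    (HomologicalComplex.homologyMap D.homothety 0)).1 inferInstance
  obtain ⟨y, hy⟩ := hepi (homologyClass (homComplex D D) 0 1 rfl ⟨z, hz⟩)
  obtain ⟨x, rfl⟩ := homologyClass_surjective _ 0 1 rfl y
  obtain ⟨r, hr⟩ : ∃ r : R, (HomologicalComplex.singleObjXSelf (ComplexShape.up ℤ) 0
      (ModuleCat.of R R)).inv.hom r = x.1 :=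
    ⟨(HomologicalComplex.singleObjXSelf (ComplexShape.up ℤ) 0 (ModuleCat.of R R)).hom.hom x.1, by
      rw [← ModuleCat.comp_apply, Iso.hom_inv_id]; rfl⟩
  have hr' := homothety_f_zero_apply D r
  rw [hr] at hr'
  have hcoc : δ 0 1 (r • Cochain.ofHom (𝟙 D)) = 0 := by simp
  have h2 := homologyMap_homologyClass D.homothety 0 1 rfl x
    ⟨r • Cochain.ofHom (𝟙 D), hcoc⟩ hr'
  have h3 := h2.symm.trans hy
  rw [← sub_eq_zero, ← map_sub, homologyClass_eq_zero_iff _ (-1) 0 1 rfl rfl] at h3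
  obtain ⟨u, hu⟩ := h3
  obtain ⟨u, rfl⟩ : ∃ u' : Cochain D D (-1), u' = u := ⟨u, rfl⟩
  have hu' : δ (-1) 0 u = r • Cochain.ofHom (𝟙 D) - z := hu
  refine ⟨r, -u, ?_⟩
  rw [δ_neg, hu']
  abel

/-- The homothety map `R → H⁰(Hom(D, D))` is injective. -/
theorem IsDualizing.eq_zero_of_smul_eq_δ (r : R) (u : Cochain D D (-1))
    (h : r • Cochain.ofHom (𝟙 D) = δ (-1) 0 u) : r = 0 := by
  have := hD.homothety_quasiIso
  have hmono := (ModuleCat.mono_iff_injective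
    (HomologicalComplex.homologyMap D.homothety 0)).1 inferInstance
  have hcoc : δ 0 1 (r • Cochain.ofHom (𝟙 D)) = 0 := by simp
  have h2 := homologyMap_homologyClass D.homothety 0 1 rfl
    ⟨(HomologicalComplex.singleObjXSelf (ComplexShape.up ℤ) 0
      (ModuleCat.of R R)).inv.hom r, by simp⟩
    ⟨r • Cochain.ofHom (𝟙 D), hcoc⟩ (homothety_f_zero_apply D r)
  have h0 : homologyClass (homComplex D D) 0 1 rfl ⟨r • Cochain.ofHom (𝟙 D), hcoc⟩ = 0 :=
    (homologyClass_eq_zero_iff (homComplex D D) (-1) 0 1 rfl rfl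
      ⟨r • Cochain.ofHom (𝟙 D), hcoc⟩).2 ⟨u, h.symm⟩
  have h3 := hmono ((h2.trans h0).trans (map_zero _).symm)
  obtain ⟨y, hy⟩ := (homologyClass_eq_zero_iff _ (-1) 0 1 rfl rfl _).1 h3
  have h4 : (HomologicalComplex.singleObjXSelf (ComplexShape.up ℤ) 0
      (ModuleCat.of R R)).inv.hom r = 0 := by simpa using hy.symm
  have h5 := congrArg (HomologicalComplex.singleObjXSelf (ComplexShape.up ℤ) 0
      (ModuleCat.of R R)).hom.hom h4
  rw [← ModuleCat.comp_apply, Iso.inv_hom_id, map_zero] at h5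
  exact h5

end Dualizing

/-! ### The functor `Hom(-, D)` and evaluation at an element -/

section Functor

variable {D : ModComplex R} {T T' : Type u} [AddCommGroup T] [Module R T] [AddCommGroup T']
  [Module R T']

/-- Precomposition with a linear map, as a map of complexes `Hom(T', D) ⟶ Hom(T, D)`. -/
def homFromMap (D : ModComplex R) (φ : T →ₗ[R] T') : homFrom T' D ⟶ homFrom T D where
  f n := ModuleCat.ofHom (LinearMap.lcomp R (D.X n) φ)
  comm' i j _ := by
    ext f
    rfl

/-- Evaluation at an element of `T`, as a map of complexes `Hom(T, D) ⟶ D`. -/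
def homFromEval (D : ModComplex R) (t : T) : homFrom T D ⟶ D where
  f n := ModuleCat.ofHom (LinearMap.applyₗ (R := R) (M₂ := D.X n) t)
  comm' i j _ := by
    ext f
    rfl

theorem homFromMap_comp_eval (φ : T →ₗ[R] T') (t : T) :
    homFromMap D φ ≫ homFromEval D t = homFromEval D (φ t) := by
  ext n f
  rfl

/-- The cochain given by evaluation at an element. -/
def evalCochain (D : ModComplex R) (t : T) : Cochain (homFrom T D) D 0 :=
  Cochain.ofHom (homFromEval D t)

theorem evalCochain_sub (t t' : T) :
    evalCochain D (t - t') = evalCochain D t - evalCochain D t' := by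
  ext n f
  simp only [evalCochain, Cochain.sub_v, Cochain.ofHom_v]
  exact map_sub (homFrom.toHom f) t t'

@[simp] theorem δ_evalCochain (t : T) (m : ℤ) : δ 0 m (evalCochain D t) = 0 := δ_ofHom _

/-- Precomposition of cochains with a map of complexes. -/
def precomp {A B : ModComplex R} (α : A ⟶ B) (n : ℤ) : Cochain B D n →ₗ[R] Cochain A D n where
  toFun z := (Cochain.ofHom α).comp z (zero_add n)
  map_add' _ _ := Cochain.comp_add _ _ _ _
  map_smul' _ _ := Cochain.comp_smul _ _ _ _

theorem precomp_v {A B : ModComplex R} (α : A ⟶ B) {n : ℤ} (z : Cochain B D n) (p q : ℤ)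
    (h : p + n = q) : (precomp α n z).v p q h = α.f p ≫ z.v p q h := by
  simp [precomp]

theorem δ_precomp {A B : ModComplex R} (α : A ⟶ B) (n m : ℤ) (z : Cochain B D n) :
    δ n m (precomp α n z) = precomp α m (δ n m z) := δ_ofHom_comp _ _ _

theorem precomp_precomp {A B C : ModComplex R} (α : A ⟶ B) (β : B ⟶ C) (n : ℤ)
    (z : Cochain C D n) : precomp α n (precomp β n z) = precomp (α ≫ β) n z := by
  ext p q h
  simp [precomp_v]

theorem precomp_evalCochain (φ : T →ₗ[R] T') (t : T) :
    precomp (homFromMap D φ) 0 (evalCochain D t) = evalCochain D (φ t) := by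
  ext p : 1
  simp only [precomp_v, evalCochain, Cochain.ofHom_v, ← homFromMap_comp_eval]
  rfl

end Functor

section ShortExact

variable {D A B C : ModComplex R} (hD : ∀ n, Injective (D.X n)) (α : A ⟶ B) (β : B ⟶ C)

include hD in
theorem precomp_surjective (hα : ∀ n, Function.Injective (α.f n).hom) (n : ℤ) :
    Function.Surjective (precomp (D := D) α n) := by
  intro z
  have h : ∀ p q (hpq : p + n = q), ∃ g : B.X p ⟶ D.X q, α.f p ≫ g = z.v p q hpq := by
    intro p q hpq
    obtain ⟨g, hg⟩ := exists_extension (hD q) _ (hα p) (z.v p q hpq).hom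
    exact ⟨ModuleCat.ofHom g, ModuleCat.hom_ext hg⟩
  choose g hg using h
  exact ⟨Cochain.mk g, by ext p q hpq : 1; simp [precomp_v, hg]⟩

theorem precomp_injective (hβ : ∀ n, Function.Surjective (β.f n).hom) (n : ℤ) :
    Function.Injective (precomp (D := D) β n) := by
  intro z z' h
  ext p q hpq : 1
  have : Epi (β.f p) := (ModuleCat.epi_iff_surjective _).2 (hβ p)
  rw [← cancel_epi (β.f p), ← precomp_v, ← precomp_v, h]

theorem exists_precomp_eq (hβ : ∀ n, Function.Surjective (β.f n).hom)
    (hex : ∀ n, Function.Exact (α.f n).hom (β.f n).hom) {n : ℤ} (z : Cochain B D n)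
    (hz : precomp α n z = 0) : ∃ w : Cochain C D n, precomp β n w = z := by
  have h : ∀ p q (hpq : p + n = q), ∃ g : C.X p ⟶ D.X q, β.f p ≫ g = z.v p q hpq := by
    intro p q hpq
    obtain ⟨g, hg⟩ := exists_descent (hβ p) (hex p) (z.v p q hpq).hom (by
      have := Cochain.congr_v hz p q hpq
      rw [precomp_v] at this
      exact congrArg ModuleCat.Hom.hom this)
    exact ⟨ModuleCat.ofHom g, ModuleCat.hom_ext hg⟩
  choose g hg using h
  exact ⟨Cochain.mk g, by ext p q hpq : 1; simp [precomp_v, hg]⟩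

include hD in
/-- In the long exact sequence of the groups `Hⁿ(Hom(-, D))` of a short exact sequence of complexes
`0 → A → B → C → 0`, a class on `A` lifts to `B` as soon as every class on `C` of degree `n + 1`
which dies on `B` is zero. -/
theorem exists_cocycle_lift (hα : ∀ n, Function.Injective (α.f n).hom)
    (hβ : ∀ n, Function.Surjective (β.f n).hom)
    (hex : ∀ n, Function.Exact (α.f n).hom (β.f n).hom) {n m l : ℤ}
    (hC : ∀ w : Cochain C D m, δ m l w = 0 → (∃ y : Cochain B D n, δ n m y = precomp β m w) →
      ∃ v : Cochain C D n, δ n m v = w)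
    (z : Cochain A D n) (hz : δ n m z = 0) :
    ∃ y : Cochain B D n, δ n m y = 0 ∧ precomp α n y = z := by
  obtain ⟨y, rfl⟩ := precomp_surjective hD α hα n z
  rw [δ_precomp] at hz
  obtain ⟨w, hw⟩ := exists_precomp_eq α β hβ hex _ hz
  obtain ⟨v, rfl⟩ := hC w (precomp_injective β hβ l (by
    rw [← δ_precomp, hw, δ_δ, map_zero])) ⟨y, hw.symm⟩
  refine ⟨y - precomp β n v, ?_, ?_⟩
  · rw [δ_sub, δ_precomp, hw, sub_self]
  · have h0 : α ≫ β = 0 := by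
      ext p x
      exact (hex p).apply_apply_eq_zero x
    rw [map_sub, precomp_precomp, h0]
    have : precomp (D := D) (0 : A ⟶ C) n v = 0 := by
      ext p q h : 1
      simp [precomp_v]
    rw [this, sub_zero]

end ShortExact

section Bidual

variable {D : ModComplex R} {T : Type u} [AddCommGroup T] [Module R T]

section Free

variable {m : ℕ}

/-- The map `D ⟶ Hom(Rᵐ, D)` sending `x` to `p ↦ pᵢ x`. -/
def toHomFromFree (D : ModComplex R) (i : Fin m) : D ⟶ homFrom (Fin m → R) D where
  f n := ModuleCat.ofHom (LinearMap.lcomp R (D.X n)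
    (LinearMap.proj (R := R) (φ := fun _ : Fin m => R) i) ∘ₗ (LinearMap.lsmul R (D.X n)).flip)
  comm' p q _ := by
    ext x
    refine LinearMap.ext fun y => ?_
    change (D.d p q).hom (y i • x) = y i • (D.d p q).hom x
    rw [map_smul]

theorem toHomFromFree_apply (i : Fin m) (n : ℤ) (x : D.X n) (y : Fin m → R) :
    homFrom.toHom (((toHomFromFree D i).f n).hom x) y = y i • x := rfl

/-- `Hom(Rᵐ, D)` is the direct sum of `m` copies of `D`. -/
theorem sum_precomp_eval_free {n : ℤ} (z : Cochain (homFrom (Fin m → R) D) D n) :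
    ∑ i, precomp (homFromEval D (Pi.single i (1 : R))) n (precomp (toHomFromFree D i) n z) = z := by
  ext p q h f
  have h1 : ∀ w : Fin m → Cochain (homFrom (Fin m → R) D) D n,
      (∑ i, w i).v p q h = ∑ i, (w i).v p q h := fun w => by
    induction (Finset.univ : Finset (Fin m)) using Finset.induction_on with
    | empty => simp
    | insert i s hi ih => rw [Finset.sum_insert hi, Finset.sum_insert hi, Cochain.add_v, ih]
  rw [h1, ModuleCat.hom_sum, LinearMap.sum_apply]
  simp only [precomp_v, ModuleCat.hom_comp, LinearMap.comp_apply, ← map_sum]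
  congr 1
  have key : ∀ g : (Fin m → R) →ₗ[R] D.X p, ∑ i : Fin m,
      homFrom.toHom (((toHomFromFree D i).f p).hom (g (Pi.single i 1))) = g := by
    intro g
    refine LinearMap.pi_ext' fun i => LinearMap.ext_ring ?_
    simp only [LinearMap.comp_apply, LinearMap.sum_apply, toHomFromFree_apply]
    rw [Finset.sum_eq_single i]
    · simp
    · intro j _ hj
      simp [hj]
    · simp
  exact key f

theorem precomp_toHomFromFree_eval (i : Fin m) (r : Fin m → R) :
    precomp (toHomFromFree D i) 0 (evalCochain D r) = r i • Cochain.ofHom (𝟙 D) := by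
  ext p x
  simp only [precomp_v, evalCochain, Cochain.ofHom_v, Cochain.smul_v]
  rfl

end Free

/-- The assertion that `Hom(Hom(T, D), D)` has no cohomology in degree `n`. -/
def BidualVanish (D : ModComplex R) (T : Type u) [AddCommGroup T] [Module R T] (n : ℤ) : Prop :=
  ∀ n' m : ℤ, n' + 1 = n → n + 1 = m → ∀ z : Cochain (homFrom T D) D n, δ n m z = 0 →
    ∃ u : Cochain (homFrom T D) D n', δ n' n u = z

/-- The assertion that `T → H⁰(Hom(Hom(T, D), D))` is surjective. -/
def BidualSurj (D : ModComplex R) (T : Type u) [AddCommGroup T] [Module R T] : Prop :=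
  ∀ z : Cochain (homFrom T D) D 0, δ 0 1 z = 0 →
    ∃ (t : T) (u : Cochain (homFrom T D) D (-1)), evalCochain D t + δ (-1) 0 u = z

/-- The assertion that `T → H⁰(Hom(Hom(T, D), D))` is injective. -/
def BidualInj (D : ModComplex R) (T : Type u) [AddCommGroup T] [Module R T] : Prop :=
  ∀ (t : T) (u : Cochain (homFrom T D) D (-1)), evalCochain D t = δ (-1) 0 u → t = 0

section FreeCase

variable (hD : D.IsDualizing) (m : ℕ)

include hD

theorem IsDualizing.bidualVanish_free {n : ℤ} (hn : n ≠ 0) : BidualVanish D (Fin m → R) n := by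
  intro n' l hn' hl z hz
  have h : ∀ i, ∃ u, δ n' n u = precomp (toHomFromFree D i) n z := fun i =>
    hD.exists_δ_eq hn' hl hn _ (by rw [δ_precomp, hz, map_zero])
  choose u hu using h
  refine ⟨∑ i, precomp (homFromEval D (Pi.single i 1)) n' (u i), ?_⟩
  rw [← sum_precomp_eval_free z, ← δ_hom_apply R, map_sum]
  simp only [δ_hom_apply, δ_precomp, hu]

theorem IsDualizing.bidualSurj_free : BidualSurj D (Fin m → R) := by
  intro z hz
  have h : ∀ i, ∃ (r : R) (u : Cochain D D (-1)), r • Cochain.ofHom (𝟙 D) + δ (-1) 0 u =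
      precomp (toHomFromFree D i) 0 z := fun i =>
    hD.exists_smul_add_δ_eq _ (by rw [δ_precomp, hz, map_zero])
  choose r u hu using h
  refine ⟨r, ∑ i, precomp (homFromEval D (Pi.single i 1)) (-1) (u i), ?_⟩
  rw [← sum_precomp_eval_free z, ← sum_precomp_eval_free (evalCochain D r), ← δ_hom_apply R,
    map_sum, ← Finset.sum_add_distrib]
  simp only [δ_hom_apply, δ_precomp, ← hu, map_add, precomp_toHomFromFree_eval]

theorem IsDualizing.bidualInj_free : BidualInj D (Fin m → R) := by
  intro r u h
  funext i
  refine hD.eq_zero_of_smul_eq_δ (r i) (precomp (toHomFromFree D i) (-1) u) ?_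
  rw [← precomp_toHomFromFree_eval, h, δ_precomp]

end FreeCase

theorem homFromMap_injective {T T' : Type u} [AddCommGroup T] [Module R T] [AddCommGroup T']
    [Module R T'] {q : T →ₗ[R] T'} (hq : Function.Surjective q) (n : ℤ) :
    Function.Injective ((homFromMap D q).f n).hom := by
  intro f g h
  refine LinearMap.ext fun x => ?_
  obtain ⟨y, rfl⟩ := hq x
  exact LinearMap.congr_fun h y

theorem homFromMap_surjective (hD : ∀ n, Injective (D.X n)) {T T' : Type u} [AddCommGroup T]
    [Module R T] [AddCommGroup T'] [Module R T'] {i : T →ₗ[R] T'} (hi : Function.Injective i)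
    (n : ℤ) : Function.Surjective ((homFromMap D i).f n).hom :=
  fun f => exists_extension (hD n) i hi f

theorem homFromMap_exact {T₁ T₂ T₃ : Type u} [AddCommGroup T₁] [Module R T₁] [AddCommGroup T₂]
    [Module R T₂] [AddCommGroup T₃] [Module R T₃] {i : T₁ →ₗ[R] T₂} {q : T₂ →ₗ[R] T₃}
    (hq : Function.Surjective q) (hiq : Function.Exact i q) (n : ℤ) :
    Function.Exact ((homFromMap D q).f n).hom ((homFromMap D i).f n).hom := by
  intro f
  constructor
  · intro hf
    exact exists_descent hq hiq f hf
  · rintro ⟨g, rfl⟩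
    refine LinearMap.ext fun x => ?_
    change homFrom.toHom g (q (i x)) = 0
    rw [hiq.apply_apply_eq_zero, map_zero]

section Steps

variable (hD : D.IsDualizing)

include hD

/-- Dimension shifting along a presentation `0 → K → Rᵐ → T → 0`. -/
theorem IsDualizing.bidualVanish_of_ker {m : ℕ} {q : (Fin m → R) →ₗ[R] T}
    (hq : Function.Surjective q) {n l : ℤ} (hn : n ≠ 0) (hl : n + 1 = l)
    (hK : ∀ w : Cochain (homFrom (LinearMap.ker q) D) D l, δ l (l + 1) w = 0 →
      (∃ y : Cochain (homFrom (Fin m → R) D) D n,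
        δ n l y = precomp (homFromMap D (LinearMap.ker q).subtype) l w) →
      ∃ v : Cochain (homFrom (LinearMap.ker q) D) D n, δ n l v = w) :
    BidualVanish D T n := by
  intro n' l' hn' hl' z hz
  obtain rfl : l' = l := by omega
  obtain ⟨y, hy, rfl⟩ := exists_cocycle_lift hD.injective (homFromMap D q)
    (homFromMap D (LinearMap.ker q).subtype) (homFromMap_injective hq)
    (homFromMap_surjective hD.injective Subtype.coe_injective)
    (homFromMap_exact hq (LinearMap.exact_subtype_ker_map q)) hK z hz
  obtain ⟨u, rfl⟩ := hD.bidualVanish_free m hn n' l' hn' hl' y hy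
  exact ⟨precomp (homFromMap D q) n' u, δ_precomp _ _ _ _⟩

theorem IsDualizing.bidualVanish_of_pos [IsNoetherianRing R] {n : ℤ} (hn : 0 < n)
    (T : Type u) [AddCommGroup T] [Module R T] [Module.Finite R T] : BidualVanish D T n := by
  obtain ⟨a, b, hab⟩ := hD.bounded
  -- descending induction on the degree, starting beyond the amplitude of `D`
  have key : ∀ k : ℕ, ∀ n : ℤ, 0 < n → b - a - k < n → ∀ (T : Type u) [AddCommGroup T] [Module R T]
      [Module.Finite R T], BidualVanish D T n := by
    intro k
    induction k with
    | zero =>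
      intro n _ hn T _ _ _ n' l hn' hl z hz
      refine ⟨0, ?_⟩
      rw [δ_zero]
      ext p q h : 1
      rcases lt_or_ge p a with hp | hp
      · have h1 := ModuleCat.subsingleton_of_isZero (hab p (Or.inl hp))
        have h2 : Subsingleton ((homFrom T D).X p) :=
          inferInstanceAs (Subsingleton (T →ₗ[R] D.X p))
        exact (ModuleCat.isZero_of_subsingleton ((homFrom T D).X p)).eq_of_src _ _
      · exact (hab q (Or.inr (by push_cast at hn; omega))).eq_of_tgt _ _
    | succ k ih =>
      intro n h0 hn T _ _ _
      obtain ⟨m, q, hq⟩ := Module.Finite.exists_fin' R T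
      refine hD.bidualVanish_of_ker hq h0.ne' rfl fun w hw _ => ?_
      exact ih (n + 1) (by omega) (by push_cast at hn; omega) (LinearMap.ker q) n _ rfl rfl w hw
  exact key (b - a).toNat n hn (by have := Int.self_le_toNat (b - a); omega) T

theorem IsDualizing.bidualSurj [IsNoetherianRing R] (T : Type u) [AddCommGroup T] [Module R T]
    [Module.Finite R T] : BidualSurj D T := by
  obtain ⟨m, q, hq⟩ := Module.Finite.exists_fin' R T
  intro z hz
  obtain ⟨y, hy, rfl⟩ := exists_cocycle_lift hD.injective (homFromMap D q)
    (homFromMap D (LinearMap.ker q).subtype) (homFromMap_injective hq)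
    (homFromMap_surjective hD.injective Subtype.coe_injective)
    (homFromMap_exact hq (LinearMap.exact_subtype_ker_map q)) (l := 2)
    (fun w hw _ => hD.bidualVanish_of_pos one_pos _ 0 2 rfl rfl w hw) z hz
  obtain ⟨t, u, rfl⟩ := hD.bidualSurj_free m y hy
  exact ⟨q t, precomp (homFromMap D q) (-1) u, by
    rw [map_add, precomp_evalCochain, δ_precomp]⟩

theorem IsDualizing.bidualInj [IsNoetherianRing R] (T : Type u) [AddCommGroup T] [Module R T]
    [Module.Finite R T] : BidualInj D T := by
  obtain ⟨m, q, hq⟩ := Module.Finite.exists_fin' R T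
  intro t u h
  obtain ⟨r, rfl⟩ := hq t
  obtain ⟨u, rfl⟩ := precomp_surjective hD.injective (homFromMap D q)
    (homFromMap_injective hq) (-1) u
  obtain ⟨w, hw⟩ := exists_precomp_eq (homFromMap D q) (homFromMap D (LinearMap.ker q).subtype)
    (homFromMap_surjective hD.injective Subtype.coe_injective)
    (homFromMap_exact hq (LinearMap.exact_subtype_ker_map q)) (evalCochain D r - δ (-1) 0 u)
    (by rw [map_sub, precomp_evalCochain, h, δ_precomp, sub_self])
  obtain ⟨k, v, rfl⟩ := hD.bidualSurj (LinearMap.ker q) w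
    (precomp_injective _ (homFromMap_surjective hD.injective Subtype.coe_injective) 1 (by
      rw [← δ_precomp, hw, δ_sub, δ_δ, δ_evalCochain, map_zero, sub_zero]))
  rw [map_add, precomp_evalCochain, ← δ_precomp, ← sub_eq_zero] at hw
  have hrk := hD.bidualInj_free m (r - k)
    (u + precomp (homFromMap D (LinearMap.ker q).subtype) (-1) v) (by
      rw [evalCochain_sub, δ_add, ← sub_eq_zero, ← neg_eq_zero, ← hw, Submodule.subtype_apply]
      abel)
  rw [sub_eq_zero.1 hrk]
  exact k.2

/-- Biduality: `Hom(Hom(T, D), D)` has cohomology only in degree `0`. -/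
theorem IsDualizing.bidualVanish [IsNoetherianRing R] {n : ℤ} (hn : n ≠ 0) (T : Type u)
    [AddCommGroup T] [Module R T] [Module.Finite R T] : BidualVanish D T n := by
  rcases hn.lt_or_gt with hn | hn
  swap
  · exact hD.bidualVanish_of_pos hn T
  have key : ∀ k : ℕ, ∀ (T : Type u) [AddCommGroup T] [Module R T] [Module.Finite R T],
      BidualVanish D T (-1 - k) := by
    intro k
    induction k with
    | zero =>
      intro T _ _ _
      obtain ⟨m, q, hq⟩ := Module.Finite.exists_fin' R T
      rw [show (-1 - ((0 : ℕ) : ℤ)) = -1 by simp]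
      refine hD.bidualVanish_of_ker hq (l := 0) (by simp) (by simp) ?_
      rintro w hw ⟨y, hy⟩
      -- a class of degree `0` on the kernel is an evaluation, and it vanishes on the free module
      obtain ⟨k, v, rfl⟩ := hD.bidualSurj (LinearMap.ker q) w hw
      rw [map_add, precomp_evalCochain, ← δ_precomp] at hy
      have hk := hD.bidualInj_free m (k : Fin m → R)
        (y - precomp (homFromMap D (LinearMap.ker q).subtype) (-1) v) (by
          rw [δ_sub]
          exact eq_sub_of_add_eq hy.symm)
      have hk' : k = 0 := Subtype.ext hk
      refine ⟨v, ?_⟩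
      have h0 : evalCochain D (0 : LinearMap.ker q) = 0 := by
        simpa using evalCochain_sub (D := D) (0 : LinearMap.ker q) 0
      rw [hk', h0, zero_add]
    | succ k ih =>
      intro T _ _ _
      obtain ⟨m, q, hq⟩ := Module.Finite.exists_fin' R T
      refine hD.bidualVanish_of_ker hq (l := -1 - k) (by push_cast; omega) (by push_cast; omega) ?_
      intro w hw _
      exact ih (LinearMap.ker q) _ _ (by push_cast; omega) rfl w hw
  obtain ⟨k, hk⟩ := Int.eq_ofNat_of_zero_le (show 0 ≤ -1 - n by omega)
  obtain rfl : n = -1 - k := by omega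
  exact key k T

end Steps

end Bidual

end Biduality

/-! ### The degree of the local Ext modules of residue fields -/

section Degree

open CochainComplex.HomComplex

variable {D : ModComplex R}

theorem ExtTors.mono {S S' : Submonoid R} (h : S ≤ S') {T : Type u} [AddCommGroup T] [Module R T]
    {n : ℤ} (hT : ExtTors S D T n) : ExtTors S' D T n := by
  intro a c ha hc f hf
  obtain ⟨s, hs, g, hg⟩ := hT a c ha hc f hf
  exact ⟨s, h hs, g, hg⟩

theorem extTors_of_forall_tors {T : Type u} [AddCommGroup T] [Module R T] [Module.Finite R T]
    {S : Submonoid R} (h : ∀ x : T, ∃ s ∈ S, s • x = 0) (n : ℤ) : ExtTors S D T n := by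
  obtain ⟨s, hs, hsT⟩ := exists_mem_forall_smul_mem S (⊥ : Submodule R T) (by simpa using h)
  exact ExtTors.of_smul_eq_zero n hs (by simpa using hsT)

/-- If `i` is the lowest degree in which `Ext(R/p, D)_p` does not vanish, then `Ext^i(T, D)_p = 0`
forces `T_p = 0`, for finitely generated `T` annihilated by `p`: up to `p`-torsion, such a `T` is
filtered by copies of `R/p`. -/
theorem forall_tors_of_extTors [IsNoetherianRing R] (hD : ∀ n, Injective (D.X n))
    {p : PrimeSpectrum R} {i : ℤ}
    (hlt : ∀ n < i, ExtTors p.asIdeal.primeCompl D (R ⧸ p.asIdeal) n)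
    (hi : ¬ ExtTors p.asIdeal.primeCompl D (R ⧸ p.asIdeal) i)
    (T : Type u) [AddCommGroup T] [Module R T] [hT : Module.Finite R T]
    (hp : ∀ r ∈ p.asIdeal, ∀ x : T, r • x = 0) (h : ExtTors p.asIdeal.primeCompl D T i) :
    ∀ x : T, ∃ s ∈ p.asIdeal.primeCompl, s • x = 0 := by
  induction hT using IsNoetherianRing.induction_on_isQuotientEquivQuotientPrime R with
  | subsingleton N => exact fun x => ⟨1, Submonoid.one_mem _, Subsingleton.elim _ _⟩
  | quotient N q e =>
    have hpq : p.asIdeal ≤ q.asIdeal := fun r hr =>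
      (forall_smul_eq_zero_iff_mem e r).1 (hp r hr)
    by_cases hqp : q.asIdeal ≤ p.asIdeal
    · obtain rfl : q = p := PrimeSpectrum.ext (le_antisymm hqp hpq)
      exact absurd (h.of_linearEquiv e) hi
    · obtain ⟨s, hsq, hsp⟩ := SetLike.not_le_iff_exists.1 hqp
      exact fun x => ⟨s, hsp, (forall_smul_eq_zero_iff_mem e s).2 hsq x⟩
  | exact N₁ N₂ N₃ f g hf hg hfg h₁ h₃ =>
    have hp₁ : ∀ r ∈ p.asIdeal, ∀ x : N₁, r • x = 0 := fun r hr x => hf (by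
      rw [map_smul, hp r hr, map_zero])
    have hp₃ : ∀ r ∈ p.asIdeal, ∀ x : N₃, r • x = 0 := fun r hr x => by
      obtain ⟨y, rfl⟩ := hg x
      rw [← map_smul, hp r hr, map_zero]
    have hN₁ : ExtTors p.asIdeal.primeCompl D N₁ (i - 1) := by
      refine ExtTors.of_primes hD p.asIdeal (fun q hpq hqp => ?_) N₁ hp₁
      obtain rfl : q = p := le_antisymm hqp hpq
      exact hlt _ (by omega)
    have h₃' := h₃ hp₃ (ExtTors.right hD hf hg hfg (by omega) hN₁ h)
    have h₁' := h₁ hp₁ (ExtTors.left hD hf hg hfg rfl h (extTors_of_forall_tors h₃' (i + 1)))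
    intro x
    obtain ⟨s, hs, hsx⟩ := h₃' (g x)
    rw [← map_smul] at hsx
    obtain ⟨y, hy⟩ := (hfg _).1 hsx
    obtain ⟨t, ht, hty⟩ := h₁' y
    exact ⟨t * s, Submonoid.mul_mem _ ht hs, by rw [mul_smul, ← hy, ← map_smul, hty, map_zero]⟩

theorem homology_homFrom_smul_eq_zero {T : Type u} [AddCommGroup T] [Module R T] {r : R}
    (hr : ∀ x : T, r • x = 0) (n : ℤ) (y : (homFrom T D).homology n) : r • y = 0 := by
  obtain ⟨f, rfl⟩ := homologyClass_surjective _ n (n + 1) rfl y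
  rw [← map_smul]
  have : r • f = 0 := Subtype.ext (LinearMap.ext fun x => by
    change r • homFrom.toHom f.1 x = 0
    rw [← map_smul, hr, map_zero])
  rw [this, map_zero]

/-- `e p` is the degree in which the local Ext modules `Ext(R/p, D)_p` are concentrated. -/
def IsDegreeFunction (D : ModComplex R) (e : PrimeSpectrum R → ℤ) : Prop :=
  ∀ p n, ExtTors p.asIdeal.primeCompl D (R ⧸ p.asIdeal) n ↔ n ≠ e p

theorem IsDualizing.finite_homology [IsNoetherianRing R] (hD : D.IsDualizing) (n : ℤ)
    (T : Type u) [AddCommGroup T] [Module R T] [Module.Finite R T] :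
    Module.Finite R ((homFrom T D).homology n) := by
  obtain ⟨a, b, hab⟩ := hD.bounded
  exact finite_homology_homFrom hD.injective
    (fun n => by
      obtain ⟨i, rfl⟩ : ∃ i, n = -i := ⟨-n, (neg_neg n).symm⟩
      exact hD.finite i) (fun n hn => hab n (Or.inl hn)) n T

/-- Biduality of `R/p` implies that `Ext(R/p, D)_p` does not vanish and is concentrated in a single
degree: it cannot vanish because `R/p` embeds in `H⁰` of its bidual, and if `i < j` were its extreme
degrees, then `Ext^i(Ext^j(R/p, D), D)_p`, a corner of a spectral sequence, would survive to the
cohomology of the bidual in the negative degree `i - j`. -/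
theorem IsDualizing.exists_isDegreeFunction [IsNoetherianRing R] (hD : D.IsDualizing) :
    ∃ e, IsDegreeFunction D e := by
  obtain ⟨a, b, hab⟩ := hD.bounded
  suffices h : ∀ p : PrimeSpectrum R, ∃ i, ∀ n,
      ExtTors p.asIdeal.primeCompl D (R ⧸ p.asIdeal) n ↔ n ≠ i by
    choose e he using h
    exact ⟨e, he⟩
  intro p
  have hfin := fun n => hD.finite_homology n (R ⧸ p.asIdeal)
  have htors : ∀ k, ExtTors p.asIdeal.primeCompl D (R ⧸ p.asIdeal) k → ∀ n,
      ExtTors p.asIdeal.primeCompl D ((homFrom (R ⧸ p.asIdeal) D).homology k) n := fun k hk =>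
    extTors_of_forall_tors ((extTors_iff _ k).1 hk)
  have hne : ∃ i, ¬ ExtTors p.asIdeal.primeCompl D (R ⧸ p.asIdeal) i := by
    by_contra! hall
    obtain ⟨t, ht, h, hth⟩ := exists_smul_eq_δ (S := p.asIdeal.primeCompl) hD.injective hab
      (n' := -1) (n := 0) (m := 1) rfl rfl (fun k => htors k (hall k) _)
      (evalCochain D (1 : R ⧸ p.asIdeal)) (δ_evalCochain _ _)
    have h1 := hD.bidualInj (R ⧸ p.asIdeal) (t • 1) h (by
      rw [← hth]
      ext n f
      simp only [evalCochain, Cochain.ofHom_v, Cochain.smul_v]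
      exact map_smul (homFrom.toHom f) t 1)
    rw [Algebra.smul_def, mul_one] at h1
    exact ht (Ideal.Quotient.eq_zero_iff_mem.1 h1)
  have hbd : ∀ n, ¬ ExtTors p.asIdeal.primeCompl D (R ⧸ p.asIdeal) n → a ≤ n ∧ n ≤ b := by
    intro n hn
    by_contra hcon
    exact hn (ExtTors.of_isZero (hab n (by omega)))
  obtain ⟨i, hi, hi'⟩ := Int.exists_least_of_bdd ⟨a, fun n hn => (hbd n hn).1⟩ hne
  obtain ⟨j, hj, hj'⟩ := Int.exists_greatest_of_bdd ⟨b, fun n hn => (hbd n hn).2⟩ hne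
  have hij : i = j := by
    by_contra hij
    have hlt : i < j := lt_of_le_of_ne (hi' j hj) hij
    have hlow : ∀ n < i, ExtTors p.asIdeal.primeCompl D (R ⧸ p.asIdeal) n := fun n hn => by
      by_contra h
      exact absurd (hi' n h) (by omega)
    have hann : ∀ k, ∀ r ∈ p.asIdeal, ∀ y : (homFrom (R ⧸ p.asIdeal) D).homology k, r • y = 0 :=
      fun k r hr y => homology_homFrom_smul_eq_zero
        ((forall_smul_eq_zero_iff_mem (LinearEquiv.refl R _) r).2 hr) k y
    obtain ⟨γ, hγ, hγ'⟩ := exists_cocycle_not_tors (S := p.asIdeal.primeCompl)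
      (M := homFrom (R ⧸ p.asIdeal) D) hD.injective hab (i := i) (j := j) (n' := i - j - 1)
      (n := i - j) (m := i - j + 1) (by omega) (by omega) rfl
      (fun h => hj ((extTors_iff _ j).2
        (forall_tors_of_extTors hD.injective hlow hi _ (hann j) h)))
      (fun k hk => by
        refine ExtTors.of_primes hD.injective p.asIdeal (fun q hpq hqp => ?_) _ (hann k)
        obtain rfl : q = p := le_antisymm hqp hpq
        exact hlow _ (by omega))
      (fun k hk => htors k (by
        by_contra h
        exact absurd (hj' k h) (by omega)) _)
    obtain ⟨u, hu⟩ := hD.bidualVanish (show i - j ≠ 0 by omega) (R ⧸ p.asIdeal) (i - j - 1)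
      (i - j + 1) (by omega) rfl γ hγ
    exact hγ' 1 (Submonoid.one_mem _) u (by rw [one_smul, hu])
  subst hij
  refine ⟨i, fun n => ⟨?_, fun hn => ?_⟩⟩
  · rintro h rfl
    exact hi h
  · by_contra h
    exact hn (le_antisymm (hj' n h) (hi' n h))

section

variable [IsNoetherianRing R] (hD : D.IsDualizing)

include hD

/-- For `r ∈ p \ q`, the module `R/(q + rR)` is filtered by copies of `R/q'` with `q' > q`, so that
the vanishing of `Ext^(n+1)(R/q', D)_p` for these `q'` implies that of `Ext^n(R/q, D)_p`. -/
theorem IsDualizing.extTors_of_lt {p q : PrimeSpectrum R} (hqp : q < p) {n : ℤ}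
    (h : ∀ q' : PrimeSpectrum R, q < q' → q' ≤ p →
      ExtTors p.asIdeal.primeCompl D (R ⧸ q'.asIdeal) (n + 1)) :
    ExtTors p.asIdeal.primeCompl D (R ⧸ q.asIdeal) n := by
  obtain ⟨r, hrp, hrq⟩ := SetLike.exists_of_lt (show q.asIdeal < p.asIdeal from hqp)
  have hfin := hD.finite_homology n (R ⧸ q.asIdeal)
  refine ExtTors.of_quotient hD.injective hrp rfl ?_ ?_
  · rw [← LinearMap.ker_eq_bot, LinearMap.ker_eq_bot']
    intro x hx
    rw [LinearMap.lsmul_apply, Algebra.smul_def] at hx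
    refine (mul_eq_zero.1 hx).resolve_left fun h0 => hrq ?_
    exact Ideal.Quotient.eq_zero_iff_mem.1 h0
  · refine ExtTors.of_primes hD.injective (q.asIdeal ⊔ Ideal.span {r}) (fun q' hq' hq'p => ?_) _ ?_
    · refine h q' (lt_of_le_of_ne (le_sup_left.trans hq') ?_) hq'p
      rintro rfl
      exact hrq (hq' (le_sup_right (a := q.asIdeal) (Ideal.mem_span_singleton_self r)))
    · intro s hs x
      obtain ⟨y, rfl⟩ := Submodule.mkQ_surjective _ x
      obtain ⟨s₁, hs₁, s₂, hs₂, rfl⟩ := Submodule.mem_sup.1 hs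
      obtain ⟨c, rfl⟩ := Ideal.mem_span_singleton'.1 hs₂
      rw [← map_smul, add_smul, (forall_smul_eq_zero_iff_mem (LinearEquiv.refl R _) s₁).2 hs₁,
        zero_add, mul_comm, mul_smul, Submodule.mkQ_apply, Submodule.Quotient.mk_eq_zero]
      exact ⟨c • y, rfl⟩

variable {e : PrimeSpectrum R → ℤ} (he : IsDegreeFunction D e)

include he

/-- The degree function increases by one along coverings of primes. -/
theorem IsDualizing.degree_eq_of_covBy {p q : PrimeSpectrum R} (hpq : p ⋖ q) :
    e q = e p + 1 := by
  by_contra h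
  -- otherwise `Ext^(e p)(R/p, D)` would vanish at `q`, hence at `p`
  refine (he p (e p)).1 (ExtTors.mono (S := q.asIdeal.primeCompl) ?_ ?_) rfl
  · exact fun s hs hsp => hs (hpq.le hsp)
  · refine hD.extTors_of_lt hpq.lt fun q' hpq' hq' => ?_
    obtain rfl : q' = q := hq'.eq_of_not_lt fun h' => hpq.2 hpq' h'
    exact (he q' _).2 (Ne.symm h)

/-- `Ext^n(T, D)_p = 0` for `n > e p` and finitely generated `T`: by Noetherian induction on `q`,
this holds for `T = R/q` with `q ≤ p`. -/
theorem IsDualizing.extTors_of_degree_lt {p : PrimeSpectrum R} {n : ℤ} (hn : e p < n)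
    (T : Type u) [AddCommGroup T] [Module R T] [Module.Finite R T] :
    ExtTors p.asIdeal.primeCompl D T n := by
  refine ExtTors.of_primes hD.injective ⊥ (fun q _ hqp => ?_) T (by simp)
  obtain ⟨I, hI⟩ : ∃ I, I = q.asIdeal := ⟨_, rfl⟩
  induction I using IsNoetherian.induction generalizing q n with
  | _ I ih =>
    subst hI
    rcases hqp.eq_or_lt with rfl | hlt
    · exact (he q n).2 hn.ne'
    · exact hD.extTors_of_lt hlt fun q' hq' hq'p =>
        ih q'.asIdeal hq' (show e p < n + 1 by omega) q' bot_le hq'p rfl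

end

end Degree

/-! ### The homology of `RHom(M, D)` -/

section Dagger

open CochainComplex.HomComplex

variable {D : ModComplex R}

/-- The support of the cohomology of `Hom(M, D)` in terms of cochains. -/
theorem mem_support_homology_homComplex_iff (M : ModComplex R) (p : PrimeSpectrum R)
    {n' n m : ℤ} (hn : n' + 1 = n) (hm : n + 1 = m) :
    p ∈ Module.support R ((homComplex M D).homology n) ↔
      ∃ γ : Cochain M D n, δ n m γ = 0 ∧
        ∀ t ∈ p.asIdeal.primeCompl, ∀ h : Cochain M D n', t • γ ≠ δ n' n h := by
  rw [Module.mem_support_iff']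
  constructor
  · rintro ⟨y, hy⟩
    obtain ⟨γ, rfl⟩ := homologyClass_surjective _ n m hm y
    refine ⟨γ.1, γ.2, fun t ht h hth => hy t ht ?_⟩
    rw [← map_smul]
    exact (homologyClass_eq_zero_iff (homComplex M D) n' n m hn hm (t • γ)).2 ⟨h, hth.symm⟩
  · rintro ⟨γ, hγ, h⟩
    refine ⟨homologyClass (homComplex M D) n m hm ⟨γ, hγ⟩, fun t ht h0 => ?_⟩
    rw [← map_smul] at h0
    obtain ⟨u, hu⟩ := (homologyClass_eq_zero_iff (homComplex M D) n' n m hn hm _).1 h0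
    exact h t ht u hu.symm

/-- Every prime of the support contains an associated prime. -/
theorem exists_le_exists_injective [IsNoetherianRing R] {N : Type*} [AddCommGroup N] [Module R N]
    {p : PrimeSpectrum R} (hp : p ∈ Module.support R N) :
    ∃ q ≤ p, ∃ f : (R ⧸ q.asIdeal) →ₗ[R] N, Function.Injective f := by
  obtain ⟨x, hx⟩ := Module.mem_support_iff_exists_annihilator.1 hp
  obtain ⟨q, hq, hqp⟩ := Ideal.exists_minimalPrimes_le hx
  have : Module.Finite R (R ∙ x) := inferInstance
  have hq' := Module.associatedPrimes.minimalPrimes_annihilator_subset_associatedPrimes R (R ∙ x) hq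
  obtain ⟨hqprime, f, hf⟩ := (isAssociatedPrime_iff_exists_injective_linearMap _ _).1 hq'
  exact ⟨⟨q, hqprime⟩, hqp, (R ∙ x).subtype ∘ₗ f, Subtype.coe_injective.comp hf⟩

variable [IsNoetherianRing R] (hD : D.IsDualizing) {e : PrimeSpectrum R → ℤ}
  (he : IsDegreeFunction D e) {M : ModComplex R} (hM : ∀ n, Module.Finite R (M.homology n))

include hD he hM

/-- If the homology of `M_p` vanishes in cohomological degrees below `j`, then that of
`RHom(M, D)_p` vanishes in degrees above `e p - j`. -/
theorem IsDualizing.notMem_support_homology {p : PrimeSpectrum R} {j n : ℤ}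
    (hj : ∀ k < j, p ∉ Module.support R (M.homology k)) (hn : e p - j < n) :
    p ∉ Module.support R ((homComplex M D).homology n) := by
  obtain ⟨a, b, hab⟩ := hD.bounded
  rw [mem_support_homology_homComplex_iff M p (n' := n - 1) (by omega) rfl]
  rintro ⟨γ, hγ, h⟩
  obtain ⟨t, ht, u, hu⟩ := exists_smul_eq_δ (S := p.asIdeal.primeCompl) hD.injective hab
    (n' := n - 1) (n := n) (by omega) rfl (fun k => by
      rcases lt_or_ge k j with hk | hk
      · exact extTors_of_forall_tors (Module.notMem_support_iff'.1 (hj k hk)) _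
      · exact hD.extTors_of_degree_lt he (by omega) _) γ hγ
  exact h t ht u hu

/-- If `j` is the lowest degree in which `M_p` has homology, and `p` is associated to `H^j(M)`, then
the bound `e p - j` for the homology of `RHom(M, D)_p` is attained. -/
theorem IsDualizing.mem_support_homology {p : PrimeSpectrum R} {j : ℤ}
    (hj : ∀ k < j, p ∉ Module.support R (M.homology k))
    (f : (R ⧸ p.asIdeal) →ₗ[R] M.homology j) (hf : Function.Injective f) :
    p ∈ Module.support R ((homComplex M D).homology (e p - j)) := by
  obtain ⟨a, b, hab⟩ := hD.bounded
  rw [mem_support_homology_homComplex_iff M p (n' := e p - j - 1) (by omega) rfl]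
  refine exists_cocycle_not_tors (S := p.asIdeal.primeCompl) hD.injective hab (i := e p)
    (j := j) (by omega) (by omega) rfl (fun h => ?_)
    (fun k hk => extTors_of_forall_tors (Module.notMem_support_iff'.1 (hj k hk)) _)
    (fun k hk => hD.extTors_of_degree_lt he (by omega) _)
  -- the functor `Ext^(e p)(-, D)_p` turns the inclusion of `R/p` into a surjection
  exact (he p (e p)).1 (ExtTors.left hD.injective hf (Submodule.mkQ_surjective _)
    (LinearMap.exact_map_mkQ_range f) rfl h
    (hD.extTors_of_degree_lt he (by omega) _)) rfl

end Dagger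

/-! ### Lengths of intervals -/

section Order

variable {α : Type*} [PartialOrder α]

/-- The length of the interval `[a, b]`, that is, the supremum of the lengths of the chains in it.
The value is meaningful if `a ≤ b` and these lengths are bounded, and `0` otherwise. -/
noncomputable def intervalDim (a b : α) : ℕ :=
  ((Order.krullDim (Set.Icc a b)).unbotD 0).toNat

/-- A function increasing by one along coverings computes the lengths of saturated chains. -/
theorem sub_eq_length {e : α → ℤ} (he : ∀ a b, a ⋖ b → e b = e a + 1)
    (t : RelSeries {(a, b) : α × α | a ⋖ b}) : e t.last - e t.head = t.length := by
  have key : ∀ k : ℕ, ∀ hk : k < t.length + 1, e (t ⟨k, hk⟩) = e t.head + k := by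
    intro k
    induction k with
    | zero => intro _; simp [RelSeries.head]
    | succ k ih =>
      intro hk
      have := he _ _ (t.step ⟨k, by omega⟩)
      have h2 := ih (by omega)
      push_cast
      rw [← add_assoc, ← h2]
      exact this
  have := key t.length (by omega)
  change e (t (Fin.last _)) - _ = _
  rw [Fin.last, this]
  ring

variable [FiniteDimensionalOrder α]

theorem krullDim_Icc_eq {a b : α} (h : a ≤ b) :
    Order.krullDim (Set.Icc a b) = (intervalDim a b : WithBot ℕ∞) := by
  have : Nonempty (Set.Icc a b) := ⟨⟨a, le_rfl, h⟩⟩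
  have h1 : Order.krullDim (Set.Icc a b) ≠ ⊥ := Order.krullDim_ne_bot_iff.2 this
  have h2 : Order.krullDim (Set.Icc a b) ≠ ⊤ := ne_top_of_le_ne_top
    Order.krullDim_ne_top_of_finiteDimensionalOrder
    (Order.krullDim_le_of_strictMono ((↑) : Set.Icc a b → α) (Subtype.strictMono_coe _))
  rw [intervalDim]
  generalize Order.krullDim (Set.Icc a b) = d at h1 h2
  induction d with
  | bot => exact absurd rfl h1
  | coe d =>
    have : d ≠ ⊤ := fun h => h2 (by rw [h]; rfl)
    lift d to ℕ using this
    rfl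

theorem intervalDim_self (a : α) : intervalDim a a = 0 := by
  have h := krullDim_Icc_eq (le_refl a)
  rw [Set.Icc_self, Order.krullDim_eq_zero] at h
  exact_mod_cast h.symm

/-- Every interval has a saturated chain of maximal length. -/
theorem exists_covBy_series {a b : α} (h : a ≤ b) :
    ∃ t : RelSeries {(a, b) : α × α | a ⋖ b}, t.head = a ∧ t.last = b ∧
      t.length = intervalDim a b := by
  have : Nonempty (Set.Icc a b) := ⟨⟨a, le_rfl, h⟩⟩
  have hfin : FiniteDimensionalOrder (Set.Icc a b) := by
    rw [Order.finiteDimensionalOrder_iff_krullDim_ne_bot_and_top, krullDim_Icc_eq h]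
    exact ⟨WithBot.coe_ne_bot, fun h => by cases WithBot.coe_injective h⟩
  have := Fact.mk h
  have hlt : WellFoundedLT (Set.Icc a b) :=
    ⟨SetRel.IsWellFounded.of_finiteDimensional {(x, y) : Set.Icc a b × Set.Icc a b | x < y}⟩
  have hgt : WellFoundedGT (Set.Icc a b) :=
    ⟨SetRel.IsWellFounded.inv_of_finiteDimensional {(x, y) : Set.Icc a b × Set.Icc a b | x < y}⟩
  obtain ⟨t, i, -, ht₁, ht₂⟩ :=
    (LTSeries.longestOf (Set.Icc a b)).exists_relSeries_covBy_and_head_eq_bot_and_last_eq_bot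
  have hcov : ∀ x y : Set.Icc a b, x ⋖ y → (x : α) ⋖ y := fun x y hxy =>
    (Set.OrdConnected.apply_covBy_apply_iff (OrderEmbedding.subtype (· ∈ Set.Icc a b))
      (by
        rw [show Set.range (OrderEmbedding.subtype (· ∈ Set.Icc a b)) = Set.Icc a b from
          Subtype.range_coe]
        exact Set.ordConnected_Icc)).2 hxy
  refine ⟨⟨t.length, fun k => (t k : α), fun k => hcov _ _ (t.step k)⟩,
    congrArg Subtype.val ht₁, congrArg Subtype.val ht₂, le_antisymm ?_ ?_⟩
  · have h1 := Order.LTSeries.length_le_krullDim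
      (⟨t.length, t, fun k => (t.step k).lt⟩ : LTSeries (Set.Icc a b))
    rw [krullDim_Icc_eq h] at h1
    exact_mod_cast h1
  · have h1 := Order.krullDim_eq_length_of_finiteDimensionalOrder (α := Set.Icc a b)
    rw [krullDim_Icc_eq h] at h1
    have h2 : intervalDim a b = (LTSeries.longestOf (Set.Icc a b)).length := by exact_mod_cast h1
    have h3 := Fintype.card_le_of_embedding i
    simp only [Fintype.card_fin] at h3
    change intervalDim a b ≤ t.length
    omega

/-- A function increasing by one along coverings computes the lengths of intervals. -/
theorem sub_eq_intervalDim {e : α → ℤ} (he : ∀ a b, a ⋖ b → e b = e a + 1) {a b : α} (h : a ≤ b) :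
    e b - e a = intervalDim a b := by
  obtain ⟨t, rfl, rfl, ht⟩ := exists_covBy_series h
  rw [← ht]
  exact sub_eq_length he t

end Order

section Catenary

variable [FiniteDimensionalOrder (PrimeSpectrum R)]

/-- In a catenary ring the lengths of intervals of primes are additive. -/
theorem intervalDim_add (hR : IsCatenaryRing R) {a b c : PrimeSpectrum R} (hab : a ≤ b)
    (hbc : b ≤ c) : intervalDim a b + intervalDim b c = intervalDim a c := by
  obtain ⟨s, rfl, hsb, hs⟩ := exists_covBy_series hab
  obtain ⟨t, htb, rfl, ht⟩ := exists_covBy_series hbc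
  obtain ⟨w, hwa, hwc, hw⟩ := exists_covBy_series (hab.trans hbc)
  have h : s.last = t.head := hsb.trans htb.symm
  rw [← hs, ← ht, ← hw]
  exact (hR _ _).2 (s.smash t h) w (RelSeries.head_smash h) (RelSeries.last_smash h) hwa hwc

/-- A function increasing by one along coverings of primes makes the ring catenary. -/
theorem isCatenaryRing_of_degree {e : PrimeSpectrum R → ℤ} (he : ∀ a b, a ⋖ b → e b = e a + 1) :
    IsCatenaryRing R := by
  intro p q
  refine ⟨⟨(LTSeries.longestOf (PrimeSpectrum R)).length,
    fun s _ _ => LTSeries.longestOf_is_longest s⟩, fun s t hsp hsq htp htq => ?_⟩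
  have hs := sub_eq_length he s
  have ht := sub_eq_length he t
  rw [hsp, hsq] at hs
  rw [htp, htq] at ht
  exact_mod_cast hs.symm.trans ht

end Catenary

/-! ### Localization -/

section Localization

theorem isZero_localizedModule_iff (N : ModuleCat.{u} R) (p : PrimeSpectrum R) :
    Limits.IsZero (N.localizedModule p.asIdeal.primeCompl) ↔ p ∉ Module.support R N := by
  rw [ModuleCat.isZero_iff_subsingleton, Module.notMem_support_iff']
  exact IsLocalizedModule.subsingleton_iff p.asIdeal.primeCompl
    (N.localizedModuleMkLinearMap p.asIdeal.primeCompl)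

/-- Homology commutes with localization. -/
noncomputable def localizationHomologyIso (M : ModComplex R) (p : PrimeSpectrum R) (n : ℤ) :
    (M.localization p).homology n ≅
      (M.homology n).localizedModule p.asIdeal.primeCompl :=
  ShortComplex.mapHomologyIso (M.sc n) (ModuleCat.localizedModuleFunctor.{u} p.asIdeal.primeCompl)

/-- The primes `p` with `H_i(M_p) ≠ 0` form the support of `H_i(M)`. -/
theorem mem_homologicalDegrees_localization (M : ModComplex R) (p : PrimeSpectrum R) (i : ℤ) :
    i ∈ (M.localization p).homologicalDegrees ↔ p ∈ Module.support R (M.homology (-i)) := by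
  rw [homologicalDegrees, Set.mem_ofPred_eq, (localizationHomologyIso M p (-i)).isZero_iff,
    isZero_localizedModule_iff, not_not]

/-- The support of a localized module is the preimage of the support. -/
theorem mem_support_iff_of_isLocalizedModule {N N' : Type*} [AddCommGroup N] [Module R N]
    (S : Submonoid R) [AddCommGroup N'] [Module R N'] [Module (Localization S) N']
    [IsScalarTower R (Localization S) N'] (f : N →ₗ[R] N') [IsLocalizedModule S f]
    (q : PrimeSpectrum (Localization S)) :
    q ∈ Module.support (Localization S) N' ↔
      PrimeSpectrum.comap (algebraMap R (Localization S)) q ∈ Module.support R N := by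
  rw [Module.mem_support_iff', Module.mem_support_iff']
  have hu : ∀ s ∈ S, algebraMap R (Localization S) s ∉ q.asIdeal := fun s hs h =>
    q.isPrime.ne_top (Ideal.eq_top_of_isUnit_mem _ h (IsLocalization.map_units _ ⟨s, hs⟩))
  constructor
  · rintro ⟨y, hy⟩
    obtain ⟨⟨x, s⟩, hxs⟩ := IsLocalizedModule.surj S f y
    refine ⟨x, fun r hr hrx => ?_⟩
    refine hy (algebraMap R (Localization S) (r * s)) ?_ ?_
    · rw [map_mul]
      exact q.isPrime.mul_notMem hr (hu s s.2)
    · change (s : R) • y = f x at hxs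
      rw [algebraMap_smul, mul_smul, hxs, ← map_smul, hrx, map_zero]
  · rintro ⟨x, hx⟩
    refine ⟨f x, fun a ha hax => ?_⟩
    obtain ⟨⟨r, s⟩, hrs⟩ := IsLocalization.surj S a
    have h0 : f (r • x) = 0 := by
      rw [map_smul, ← algebraMap_smul (Localization S) r, ← hrs, mul_comm, mul_smul, hax,
        smul_zero]
    obtain ⟨t, ht⟩ := (IsLocalizedModule.eq_zero_iff S f).1 h0
    refine hx (t * r) ?_ (by rw [mul_smul]; exact ht)
    intro h
    rw [PrimeSpectrum.comap_asIdeal, Ideal.mem_comap, map_mul, ← hrs] at h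
    exact q.isPrime.mul_notMem (hu t t.2) (q.isPrime.mul_notMem ha (hu s s.2)) h

/-- Iterated localization: `(M_p)_q` has homology in the same degrees as the localization of `M` at
the preimage of `q` in `R`. -/
theorem homologicalDegrees_localization_localization (M : ModComplex R) (p : PrimeSpectrum R)
    (q : PrimeSpectrum (Localization.AtPrime p.asIdeal)) :
    ((M.localization p).localization q).homologicalDegrees =
      (M.localization
        (PrimeSpectrum.comap
          (algebraMap R (Localization.AtPrime p.asIdeal)) q)).homologicalDegrees := by
  ext i
  rw [mem_homologicalDegrees_localization, mem_homologicalDegrees_localization,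
    (localizationHomologyIso M p (-i)).toLinearEquiv.support_eq]
  exact mem_support_iff_of_isLocalizedModule p.asIdeal.primeCompl
    ((M.homology (-i)).localizedModuleMkLinearMap p.asIdeal.primeCompl) q

theorem mem_support_iff (M : ModComplex R) (p : PrimeSpectrum R) :
    p ∈ M.support ↔ (M.localization p).homologicalDegrees.Nonempty := by
  rw [← not_iff_not, Set.not_nonempty_iff_eq_empty, Set.eq_empty_iff_forall_notMem]
  simp only [support, Set.mem_ofPred_eq, not_not, homologicalDegrees]
  constructor
  · exact fun h i => (HomologicalComplex.exactAt_iff_isZero_homology _ _).1 (h (-i))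
  · exact fun h i => (HomologicalComplex.exactAt_iff_isZero_homology _ _).2
      (neg_neg i ▸ h (-i))

theorem homologicalDegrees_localization_mono (M : ModComplex R) {p q : PrimeSpectrum R}
    (h : p ≤ q) :
    (M.localization p).homologicalDegrees ⊆ (M.localization q).homologicalDegrees := by
  intro i hi
  rw [mem_homologicalDegrees_localization] at hi ⊢
  exact Module.mem_support_mono h hi

theorem mem_support_of_le (M : ModComplex R) {p q : PrimeSpectrum R} (h : p ≤ q)
    (hp : p ∈ M.support) : q ∈ M.support := by
  rw [mem_support_iff] at hp ⊢
  exact hp.mono (homologicalDegrees_localization_mono M h)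

theorem homologicalDegrees_localization_subset (M : ModComplex R) (p : PrimeSpectrum R) :
    (M.localization p).homologicalDegrees ⊆ M.homologicalDegrees := by
  intro i hi h
  rw [mem_homologicalDegrees_localization] at hi
  have := ModuleCat.isZero_iff_subsingleton.1 h
  exact not_nontrivial _ (Module.nonempty_support_iff.1 ⟨p, hi⟩)

theorem homologicalDegrees_localization_closedPoint [IsLocalRing R] (M : ModComplex R) :
    (M.localization (IsLocalRing.closedPoint R)).homologicalDegrees = M.homologicalDegrees := by
  refine (homologicalDegrees_localization_subset M _).antisymm fun i hi => ?_
  rw [mem_homologicalDegrees_localization]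
  have : Nontrivial (M.homology (-i)) := by
    rw [← not_subsingleton_iff_nontrivial, ← ModuleCat.isZero_iff_subsingleton]
    exact hi
  obtain ⟨p, hp⟩ := Module.nonempty_support_of_nontrivial (R := R) (M := M.homology (-i))
  exact Module.mem_support_mono (IsLocalRing.le_maximalIdeal p.isPrime.ne_top) hp

end Localization

section Dim

theorem krullDimEReal_of_eq_natCast {A : Type u} [CommRing A] {n : ℕ}
    (h : ringKrullDim A = (n : WithBot ℕ∞)) : krullDimEReal A = ((n : ℝ) : EReal) := by
  rw [krullDimEReal, h]
  rfl

theorem krullDimEReal_quotient [IsNoetherianRing R] [IsLocalRing R] (p : PrimeSpectrum R) :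
    krullDimEReal (R ⧸ p.asIdeal) =
      ((intervalDim p (IsLocalRing.closedPoint R) : ℝ) : EReal) := by
  have hle : ∀ q : PrimeSpectrum R, q ≤ IsLocalRing.closedPoint R := fun q =>
    IsLocalRing.le_maximalIdeal q.isPrime.ne_top
  refine krullDimEReal_of_eq_natCast ?_
  rw [ringKrullDim_quotient, ← krullDim_Icc_eq (hle p)]
  rw [show PrimeSpectrum.zeroLocus (p.asIdeal : Set R) =
    Set.Icc p (IsLocalRing.closedPoint R) from Set.ext fun q => ⟨fun h => ⟨h, hle q⟩, fun h => h.1⟩]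

/-- The primes of `R_p` form the interval of primes below `p`. -/
theorem krullDimEReal_localization_quotient [FiniteDimensionalOrder (PrimeSpectrum R)]
    (p : PrimeSpectrum R) (q : PrimeSpectrum (Localization.AtPrime p.asIdeal)) :
    krullDimEReal (Localization.AtPrime p.asIdeal ⧸ q.asIdeal) =
      ((intervalDim (PrimeSpectrum.comap (algebraMap R (Localization.AtPrime p.asIdeal)) q) p : ℝ) :
        EReal) := by
  set g := IsLocalization.AtPrime.primeSpectrumOrderIso (Localization.AtPrime p.asIdeal) p.asIdeal
  have hg : ∀ q, (g q : PrimeSpectrum R) =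
      PrimeSpectrum.comap (algebraMap R (Localization.AtPrime p.asIdeal)) q := fun _ => rfl
  have hle : ∀ q, PrimeSpectrum.comap (algebraMap R (Localization.AtPrime p.asIdeal)) q ≤ p :=
    fun q => (g q).2
  refine krullDimEReal_of_eq_natCast ?_
  rw [ringKrullDim_quotient, ← krullDim_Icc_eq (hle q)]
  have hmem : ∀ x, x ∈ PrimeSpectrum.zeroLocus (q.asIdeal : Set (Localization.AtPrime p.asIdeal)) ↔
      q ≤ x := fun x => Iff.rfl
  simp_rw [← hg] at hle ⊢
  let F : PrimeSpectrum.zeroLocus (q.asIdeal : Set (Localization.AtPrime p.asIdeal)) ↪o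
      Set.Icc (g q : PrimeSpectrum R) p :=
    OrderEmbedding.ofMapLEIff (fun x => ⟨g x.1, g.monotone ((hmem _).1 x.2), (g x.1).2⟩)
      fun x y => g.le_iff_le (x := x.1) (y := y.1)
  refine Order.krullDim_eq_of_orderIso (RelIso.ofSurjective F ?_)
  rintro ⟨y, hy₁, hy₂⟩
  obtain ⟨x, hx⟩ := g.surjective ⟨y, hy₂⟩
  refine ⟨⟨x, ?_⟩, Subtype.ext (show (g x : PrimeSpectrum R) = y by rw [hx])⟩
  have : g q ≤ g x := by rw [hx]; exact hy₁
  exact (hmem _).2 (g.le_iff_le.1 this)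

end Dim

/-! ### Dimension as a maximum of integers -/

theorem le_closedPoint [IsLocalRing R] (p : PrimeSpectrum R) : p ≤ IsLocalRing.closedPoint R :=
  IsLocalRing.le_maximalIdeal p.isPrime.ne_top

theorem hInf_eq_of_isLeast {M : ModComplex R} {i : ℤ} (h : IsLeast M.homologicalDegrees i) :
    M.hInf = ((i : ℝ) : EReal) :=
  le_antisymm (iInf₂_le i h.1) (le_iInf₂ fun _ hj => by exact_mod_cast h.2 hj)

theorem hSup_eq_of_isGreatest {M : ModComplex R} {i : ℤ} (h : IsGreatest M.homologicalDegrees i) :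
    M.hSup = ((i : ℝ) : EReal) :=
  le_antisymm (iSup₂_le fun _ hj => by exact_mod_cast h.2 hj)
    (le_iSup₂ (f := fun (i : ℤ) (_ : i ∈ M.homologicalDegrees) => ((i : ℝ) : EReal)) i h.1)

theorem hInf_congr {R' : Type u} [CommRing R'] {M : ModComplex R} {N : ModComplex R'}
    (h : M.homologicalDegrees = N.homologicalDegrees) : M.hInf = N.hInf := by
  rw [hInf, hInf, h]

/-- The integer `ι p` is `inf M_p` for all `p` in the support of `M`; the values at other primes are
arbitrary. -/
def IsInfFunction (M : ModComplex R) (ι : PrimeSpectrum R → ℤ) : Prop :=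
  ∀ p ∈ M.support, IsLeast (M.localization p).homologicalDegrees (ι p)

/-- The integer `δ p` is the maximum of the numbers `dim R_p/q - ι q`, for all `p` in the support of
`M`; if `ι` gives the infima, it is `dim M_p`. The values at other primes are arbitrary. -/
def IsDimFunction (M : ModComplex R) (ι δ : PrimeSpectrum R → ℤ) : Prop :=
  ∀ p ∈ M.support, IsGreatest {d : ℤ | ∃ q ∈ M.support, q ≤ p ∧ d = intervalDim q p - ι q} (δ p)

theorem HomologicallyBoundedBelow.exists_isInfFunction {M : ModComplex R}
    (hM : M.HomologicallyBoundedBelow) : ∃ ι, IsInfFunction M ι := by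
  obtain ⟨a, ha⟩ := hM
  have key : ∀ p : PrimeSpectrum R, ∃ i : ℤ, p ∈ M.support →
      IsLeast (M.localization p).homologicalDegrees i := by
    intro p
    by_cases hp : p ∈ M.support
    · obtain ⟨i, hi, hi'⟩ := Int.exists_least_of_bdd
        ⟨a, fun z hz => ha z (homologicalDegrees_localization_subset M p hz)⟩
        ((mem_support_iff M p).1 hp)
      exact ⟨i, fun _ => ⟨hi, hi'⟩⟩
    · exact ⟨0, fun h => absurd h hp⟩
  choose ι hι using key
  exact ⟨ι, hι⟩

theorem intervalDim_le_length [FiniteDimensionalOrder (PrimeSpectrum R)] {p q : PrimeSpectrum R}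
    (h : p ≤ q) : intervalDim p q ≤ (LTSeries.longestOf (PrimeSpectrum R)).length := by
  obtain ⟨t, -, -, ht⟩ := exists_covBy_series h
  rw [← ht]
  exact LTSeries.longestOf_is_longest ⟨t.length, t, fun k => (t.step k).lt⟩

theorem HomologicallyBoundedBelow.exists_isDimFunction [FiniteDimensionalOrder (PrimeSpectrum R)]
    {M : ModComplex R} (hM : M.HomologicallyBoundedBelow) {ι : PrimeSpectrum R → ℤ}
    (hι : IsInfFunction M ι) : ∃ δ, IsDimFunction M ι δ := by
  obtain ⟨a, ha⟩ := hM
  have key : ∀ p : PrimeSpectrum R, ∃ d : ℤ, p ∈ M.support →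
      IsGreatest {d : ℤ | ∃ q ∈ M.support, q ≤ p ∧ d = intervalDim q p - ι q} d := by
    intro p
    by_cases hp : p ∈ M.support
    · obtain ⟨i, hi, hi'⟩ := Int.exists_greatest_of_bdd
        (P := fun d => ∃ q ∈ M.support, q ≤ p ∧ d = intervalDim q p - ι q)
        ⟨(LTSeries.longestOf (PrimeSpectrum R)).length - a, by
          rintro z ⟨q, hq, hqp, rfl⟩
          have h1 := ha _ (homologicalDegrees_localization_subset M q (hι q hq).1)
          have h2 := intervalDim_le_length hqp
          omega⟩
        ⟨_, p, hp, le_rfl, rfl⟩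
      exact ⟨i, fun _ => ⟨hi, hi'⟩⟩
    · exact ⟨0, fun h => absurd h hp⟩
  choose δ hδ using key
  exact ⟨δ, hδ⟩

theorem dim_localization [FiniteDimensionalOrder (PrimeSpectrum R)] (M : ModComplex R)
    (p : PrimeSpectrum R) :
    (M.localization p).dim = ⨆ q ∈ M.support, ⨆ (_ : q ≤ p),
      (((intervalDim q p : ℝ) : EReal) - (M.localization q).hInf) := by
  have key : ∀ q : PrimeSpectrum (Localization.AtPrime p.asIdeal), q ∈ (M.localization p).support ↔
      PrimeSpectrum.comap (algebraMap R (Localization.AtPrime p.asIdeal)) q ∈ M.support := by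
    intro q
    rw [mem_support_iff, mem_support_iff, homologicalDegrees_localization_localization]
  refine le_antisymm (iSup₂_le fun q hq => ?_) (iSup₂_le fun q hq => iSup_le fun hqp => ?_)
  · rw [krullDimEReal_localization_quotient,
      hInf_congr (homologicalDegrees_localization_localization M p q)]
    exact le_iSup₂_of_le _ ((key q).1 hq) (le_iSup_of_le
      (IsLocalization.AtPrime.primeSpectrumOrderIso (Localization.AtPrime p.asIdeal) p.asIdeal q).2
      le_rfl)
  · obtain ⟨q', hq'⟩ := (IsLocalization.AtPrime.primeSpectrumOrderIso
      (Localization.AtPrime p.asIdeal) p.asIdeal).surjective ⟨q, hqp⟩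
    obtain rfl : PrimeSpectrum.comap (algebraMap R (Localization.AtPrime p.asIdeal)) q' = q :=
      congrArg Subtype.val hq'
    refine le_iSup₂_of_le q' ((key q').2 hq) ?_
    rw [krullDimEReal_localization_quotient,
      hInf_congr (homologicalDegrees_localization_localization M p q')]

theorem IsDimFunction.dim_localization_eq [FiniteDimensionalOrder (PrimeSpectrum R)]
    {M : ModComplex R} {ι δ : PrimeSpectrum R → ℤ} (hδ : IsDimFunction M ι δ)
    (hι : IsInfFunction M ι) {p : PrimeSpectrum R} (hp : p ∈ M.support) :
    (M.localization p).dim = ((δ p : ℝ) : EReal) := by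
  rw [dim_localization]
  have h : ∀ q ∈ M.support, ((intervalDim q p : ℝ) : EReal) - (M.localization q).hInf =
      (((intervalDim q p - ι q : ℤ) : ℝ) : EReal) := fun q hq => by
    rw [hInf_eq_of_isLeast (hι q hq)]
    push_cast
    rfl
  refine le_antisymm (iSup₂_le fun q hq => iSup_le fun hqp => ?_) ?_
  · rw [h q hq]
    exact_mod_cast (hδ p hp).2 ⟨q, hq, hqp, rfl⟩
  · obtain ⟨q, hq, hqp, hd⟩ := (hδ p hp).1
    rw [hd, ← h q hq]
    exact le_iSup₂_of_le q hq (le_iSup_of_le hqp le_rfl)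

section Local

variable [IsNoetherianRing R] [IsLocalRing R]

theorem dim_localization_closedPoint (M : ModComplex R) :
    (M.localization (IsLocalRing.closedPoint R)).dim = M.dim := by
  rw [dim_localization, dim]
  refine iSup_congr fun q => iSup_congr fun _ => ?_
  rw [iSup_pos (le_closedPoint q), krullDimEReal_quotient]

/-- Equidimensionality in terms of the integers `inf M_p` and `dim M_p`. -/
theorem isEquidimensional_iff_of_isDimFunction {M : ModComplex R} {ι δ : PrimeSpectrum R → ℤ}
    (hι : IsInfFunction M ι) (hδ : IsDimFunction M ι δ) :
    M.IsEquidimensional ↔ ∀ p ∈ M.support, (δ p = -ι p ↔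
      (intervalDim p (IsLocalRing.closedPoint R) : ℤ) = δ (IsLocalRing.closedPoint R) + ι p) := by
  rw [IsEquidimensional, Set.ext_iff]
  refine forall_congr' fun p => ?_
  rw [anchorPrimes, Set.mem_sep_iff, Set.mem_sep_iff, and_congr_right_iff]
  refine forall_congr' fun hp => ?_
  have hm := mem_support_of_le M (le_closedPoint p) hp
  rw [hδ.dim_localization_eq hι hp, hInf_eq_of_isLeast (hι p hp), krullDimEReal_quotient,
    ← dim_localization_closedPoint, hδ.dim_localization_eq hι hm]
  norm_cast

/-- If `R` is catenary, the anchor primes `q ≤ p` at which `dim M_p` is attained force the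
dimension formula for equidimensional complexes. -/
theorem isEquidimensional_iff_forall_add {M : ModComplex R} {ι δ : PrimeSpectrum R → ℤ}
    (hR : IsCatenaryRing R) (hι : IsInfFunction M ι) (hδ : IsDimFunction M ι δ) :
    M.IsEquidimensional ↔ ∀ p ∈ M.support, δ (IsLocalRing.closedPoint R) =
      δ p + intervalDim p (IsLocalRing.closedPoint R) := by
  rw [isEquidimensional_iff_of_isDimFunction hι hδ]
  refine ⟨fun h p hp => ?_, fun h p hp => ?_⟩
  · obtain ⟨q, hq, hqp, hd⟩ := (hδ p hp).1
    have hadd := intervalDim_add hR hqp (le_closedPoint p)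
    -- a prime at which the maximum `dim M_p` is attained is an anchor prime
    have hanc : δ q = -ι q := by
      refine le_antisymm ?_ ?_
      · obtain ⟨r, hr, hrq, hd'⟩ := (hδ q hq).1
        have h1 := (hδ p hp).2 ⟨r, hr, hrq.trans hqp, rfl⟩
        have h2 := intervalDim_add hR hrq hqp
        omega
      · refine (hδ q hq).2 ⟨q, hq, le_rfl, ?_⟩
        rw [intervalDim_self]
        simp
    have := (h q hq).1 hanc
    omega
  · have := h p hp
    omega

end Local

/-! ### Equidimensionality of the dagger dual -/

/-- The integer `s p` is `sup M_p` for all `p` in the support of `M`; the values at other primes are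
arbitrary. -/
def IsSupFunction (M : ModComplex R) (s : PrimeSpectrum R → ℤ) : Prop :=
  ∀ p ∈ M.support, IsGreatest (M.localization p).homologicalDegrees (s p)

theorem HomologicallyBoundedAbove.exists_isSupFunction {M : ModComplex R}
    (hM : M.HomologicallyBoundedAbove) : ∃ s, IsSupFunction M s := by
  obtain ⟨b, hb⟩ := hM
  have key : ∀ p : PrimeSpectrum R, ∃ i : ℤ, p ∈ M.support →
      IsGreatest (M.localization p).homologicalDegrees i := by
    intro p
    by_cases hp : p ∈ M.support
    · obtain ⟨i, hi, hi'⟩ := Int.exists_greatest_of_bdd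
        ⟨b, fun z hz => hb z (homologicalDegrees_localization_subset M p hz)⟩
        ((mem_support_iff M p).1 hp)
      exact ⟨i, fun _ => ⟨hi, hi'⟩⟩
    · exact ⟨0, fun h => absurd h hp⟩
  choose s hs using key
  exact ⟨s, hs⟩

theorem IsSupFunction.mono {M : ModComplex R} {s : PrimeSpectrum R → ℤ} (hs : IsSupFunction M s)
    {p q : PrimeSpectrum R} (hqp : q ≤ p) (hq : q ∈ M.support) : s q ≤ s p :=
  (hs p (mem_support_of_le M hqp hq)).2
    (homologicalDegrees_localization_mono M hqp (hs q hq).1)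

theorem IsSupFunction.notMem_support_homology {M : ModComplex R} {s : PrimeSpectrum R → ℤ}
    (hs : IsSupFunction M s) {p : PrimeSpectrum R} (hp : p ∈ M.support) :
    ∀ k < -s p, p ∉ Module.support R (M.homology k) := by
  intro k hk h
  rw [← neg_neg k, ← mem_homologicalDegrees_localization] at h
  have := (hs p hp).2 h
  omega

section

variable [IsNoetherianRing R] {D : ModComplex R} (hD : D.IsDualizing) {e : PrimeSpectrum R → ℤ}
  (he : IsDegreeFunction D e) {M : ModComplex R} (hM : ∀ n, Module.Finite R (M.homology n))

include hD he hM

theorem IsDualizing.support_dagger_subset : (M.dagger D).support ⊆ M.support := by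
  intro p hp
  by_contra hpM
  obtain ⟨i, hi⟩ := (mem_support_iff _ p).1 hp
  rw [mem_homologicalDegrees_localization] at hi
  refine hD.notMem_support_homology he hM (j := e p + i + 1) (fun k _ hk => hpM ?_)
    (by omega) hi
  rw [mem_support_iff]
  exact ⟨-k, (mem_homologicalDegrees_localization M p _).2 (by rwa [neg_neg])⟩

variable {s : PrimeSpectrum R → ℤ} (hs : IsSupFunction M s)

include hs

theorem IsDualizing.neg_le_of_mem_homologicalDegrees_dagger {p : PrimeSpectrum R}
    (hp : p ∈ M.support) {i : ℤ} (hi : i ∈ ((M.dagger D).localization p).homologicalDegrees) :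
    -(e p + s p) ≤ i := by
  rw [mem_homologicalDegrees_localization] at hi
  by_contra h
  exact hD.notMem_support_homology he hM (hs.notMem_support_homology hp) (by omega) hi

/-- The equality `inf (M^†)_q = -(e q + sup M_p)` holds at a prime `q ≤ p` associated to the top
homology module of `M_p`. -/
theorem IsDualizing.exists_le_mem_homologicalDegrees_dagger {p : PrimeSpectrum R}
    (hp : p ∈ M.support) : ∃ q ≤ p, q ∈ M.support ∧ s q = s p ∧
      -(e q + s q) ∈ ((M.dagger D).localization q).homologicalDegrees := by
  have h := (hs p hp).1
  rw [mem_homologicalDegrees_localization] at h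
  obtain ⟨q, hqp, f, hf⟩ := exists_le_exists_injective h
  have hq : s p ∈ (M.localization q).homologicalDegrees := by
    rw [mem_homologicalDegrees_localization]
    refine Module.support_subset_of_injective f hf ?_
    rw [Module.mem_support_iff']
    refine ⟨1, fun r hr h0 => hr ?_⟩
    rw [← Ideal.Quotient.eq_zero_iff_mem]
    simpa [Algebra.smul_def] using h0
  have hqM : q ∈ M.support := (mem_support_iff M q).2 ⟨_, hq⟩
  have hsq : s q = s p := le_antisymm (hs.mono hqp hqM) ((hs q hqM).2 hq)
  refine ⟨q, hqp, hqM, hsq, ?_⟩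
  rw [mem_homologicalDegrees_localization]
  have hmem := hD.mem_support_homology he hM
    (fun k hk => hs.notMem_support_homology hqM k (by rwa [hsq])) f hf
  rwa [show e q - -s p = - -(e q + s q) by omega] at hmem

theorem IsDualizing.support_dagger : (M.dagger D).support = M.support := by
  refine (hD.support_dagger_subset he hM).antisymm fun p hp => ?_
  obtain ⟨q, hqp, -, -, h⟩ := hD.exists_le_mem_homologicalDegrees_dagger he hM hs hp
  exact mem_support_of_le _ hqp ((mem_support_iff _ q).2 ⟨_, h⟩)

/-- The dimension of the dagger dual: `dim (M^†)_p = e p + sup M_p`. Each `q ≤ p` contributes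
`dim R_p/q - inf (M^†)_q ≤ (e p - e q) + (e q + sup M_q) ≤ e p + sup M_p`. -/
theorem IsDualizing.isDimFunction_dagger [FiniteDimensionalOrder (PrimeSpectrum R)]
    {ι : PrimeSpectrum R → ℤ} (hι : IsInfFunction (M.dagger D) ι) :
    IsDimFunction (M.dagger D) ι (fun p => e p + s p) := by
  have hsub := fun a b (hab : a ≤ b) =>
    sub_eq_intervalDim (e := e) (fun a b h => hD.degree_eq_of_covBy he h) hab
  have hsupp := hD.support_dagger he hM hs
  intro p hp
  rw [hsupp] at hp
  constructor
  · obtain ⟨q, hqp, hq, hsq, h⟩ := hD.exists_le_mem_homologicalDegrees_dagger he hM hs hp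
    have hq' := hq
    rw [← hsupp] at hq'
    refine ⟨q, hq', hqp, ?_⟩
    have h1 := (hι q hq').2 h
    have h2 := hD.neg_le_of_mem_homologicalDegrees_dagger he hM hs hq (hι q hq').1
    have h3 := hsub q p hqp
    dsimp only
    omega
  · rintro _ ⟨q, hq', hqp, rfl⟩
    have hq := hq'
    rw [hsupp] at hq
    have h2 := hD.neg_le_of_mem_homologicalDegrees_dagger he hM hs hq (hι q hq').1
    have h3 := hsub q p hqp
    have h4 := hs.mono hqp hq
    dsimp only
    omega

theorem IsDualizing.homologicallyBoundedBelow_dagger [IsLocalRing R]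
    (hb : M.HomologicallyBoundedAbove) : (M.dagger D).HomologicallyBoundedBelow := by
  obtain ⟨b, hb⟩ := hb
  refine ⟨-(e (IsLocalRing.closedPoint R) + b), fun i hi => ?_⟩
  rw [← homologicalDegrees_localization_closedPoint] at hi
  have hm : IsLocalRing.closedPoint R ∈ M.support :=
    hD.support_dagger_subset he hM ((mem_support_iff _ _).2 ⟨_, hi⟩)
  have h1 := hD.neg_le_of_mem_homologicalDegrees_dagger he hM hs hm hi
  have h2 := hb _ (homologicalDegrees_localization_subset M _ (hs _ hm).1)
  omega

end

variable [IsNoetherianRing R] [IsLocalRing R]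

theorem isEquidimensional_iff_dim_eq (hR : IsCatenaryRing R) {M : ModComplex R}
    (hM : M.HomologicallyBoundedBelow) :
    M.IsEquidimensional ↔
      ∀ p ∈ M.support, M.dim = (M.localization p).dim + krullDimEReal (R ⧸ p.asIdeal) := by
  obtain ⟨ι, hι⟩ := hM.exists_isInfFunction
  obtain ⟨δ, hδ⟩ := hM.exists_isDimFunction hι
  rw [isEquidimensional_iff_forall_add hR hι hδ]
  refine forall₂_congr fun p hp => ?_
  have hm := mem_support_of_le M (le_closedPoint p) hp
  rw [← dim_localization_closedPoint, hδ.dim_localization_eq hι hp, hδ.dim_localization_eq hι hm,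
    krullDimEReal_quotient]
  norm_cast

/-- Since `dim (M^†)_p = e p + sup M_p` and `dim R/p = e m - e p`, the dimension formula for `M^†`
reads `sup M = sup M_p`, where `m` is the maximal ideal. -/
theorem IsDualizing.isEquidimensional_dagger_iff {D : ModComplex R} (hD : D.IsDualizing)
    {M : ModComplex R} (hM : M.HomologicallyBoundedFinite) :
    (M.dagger D).IsEquidimensional ↔ ∀ p ∈ M.support, M.hSup = (M.localization p).hSup := by
  have hfin : ∀ n, Module.Finite R (M.homology n) := fun n => by
    obtain ⟨i, rfl⟩ : ∃ i, n = -i := ⟨-n, (neg_neg n).symm⟩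
    exact hM.finite i
  obtain ⟨e, he⟩ := hD.exists_isDegreeFunction
  have hcov : ∀ a b : PrimeSpectrum R, a ⋖ b → e b = e a + 1 := fun a b h =>
    hD.degree_eq_of_covBy he h
  obtain ⟨s, hs⟩ := hM.above.exists_isSupFunction
  obtain ⟨ι, hι⟩ := (hD.homologicallyBoundedBelow_dagger he hfin hs
    hM.above).exists_isInfFunction
  rw [isEquidimensional_iff_forall_add (isCatenaryRing_of_degree hcov) hι
    (hD.isDimFunction_dagger he hfin hs hι), hD.support_dagger he hfin hs]
  refine forall₂_congr fun p hp => ?_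
  have hm := hs _ (mem_support_of_le M (le_closedPoint p) hp)
  rw [homologicalDegrees_localization_closedPoint] at hm
  rw [hSup_eq_of_isGreatest hm, hSup_eq_of_isGreatest (hs p hp),
    ← sub_eq_intervalDim hcov (le_closedPoint p)]
  norm_cast
  constructor <;> intro h <;> omega

end ModComplex

theorem mainTheorem11 (R : Type u) [CommRing R] [IsNoetherianRing R] [IsLocalRing R] :
    (IsCatenaryRing R → ∀ M : ModComplex R, M.HomologicallyBoundedBelow →
      (M.IsEquidimensional ↔
        ∀ p ∈ M.support, M.dim = (M.localization p).dim + krullDimEReal (R ⧸ p.asIdeal))) ∧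
    (∀ D : ModComplex R, D.IsNormalizedDualizing →
      ∀ M : ModComplex R, M.HomologicallyBoundedFinite →
        ((M.dagger D).IsEquidimensional ↔
          ∀ p ∈ M.support, M.hSup = (M.localization p).hSup)) :=
  ⟨fun hR _ hM => ModComplex.isEquidimensional_iff_dim_eq hR hM,
    fun _ hD _ hM => hD.toIsDualizing.isEquidimensional_dagger_iff hM⟩
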